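/- **Setting.** Finitely many rigid bodies are given by triangle meshes on the vertices $1,\dots,V$. Each vertex belongs to one body, and each triangle $t$ has three distinct vertices, all on one body; we also write $t$ for its vertex set. A configuration is $x=(x_1,\dots,x_V)\in\mathbb R^{3V}$. A rest configuration $\bar x$ is fixed, and the configuration space $\mathcal C\subseteq\mathbb R^{3V}$ is any set of configurations in which each body is congruent to its rest shape, i.e. $\|x_i-x_j\|=\|\bar x_i-\bar x_j\|$ for all $i,j$ on the same body. For a vertex set $\mathcal I$ let $x_{\mathcal I}=|\mathcal I|^{-1}\sum_{i\in\mathcal I}x_i$ and $\mathrm{CH}(x_{\mathcal I})=\mathrm{conv}\{x_i:i\in\mathcal I\}$. Let $\mathcal C_{\rm obs}$ be the set of $x\in\mathcal C$ for which $\mathrm{CH}(x_{s})\cap \mathrm{CH}(x_{t})\ne\emptyset$ for some triangles $s,t$ on different bodies, and $\mathcal C_{\rm free}=\mathcal C\setminus\mathcal C_{\rm obs}$. **Bounding sphere hierarchy.** Each body carries a binary tree whose leaves store single triangles, precisely the triangles of that body. The vertex set of a leaf is that of its triangle, and that of an internal node is the union of those of its two children; a node is denoted by its vertex set $\mathcal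 I$. Radii are computed in the rest configuration and then kept fixed: a leaf $t$ has a radius $R_t>0$ with $R_t\ge\max_{i\in t}\|\bar x_i-\bar x_t\|$, and an internal node $\mathcal I$ has the least radius of a ball about $\bar x_{\mathcal I}$ containing the balls of both children, $R_{\mathcal I}=\max_{c}(\|\bar x_{\mathcal I_c}-\bar x_{\mathcal I}\|+R_{\mathcal I_c})$. **Potential.** All potentials are functions $\mathbb R^{3V}\to[0,\infty]$, with $0\cdot\infty=0$ and $1/s^+=1/\max(s,0)$ ($=\infty$ for $s\le 0$). For triangles $s,t$ put $$\mathcal P^{s\cup t}(x)=\inf_{n\in\mathbb R^3,\,d\in\mathbb R}\Big[\frac{12}{(1-\|n\|)^+}+\sum_{i\in s}\frac1{(\langle x_i,n\rangle+d)^+}+\sum_{j\in t}\frac1{(\langle x_j,-n\rangle-d)^+}\Big],$$ and for nodes put $\mathcal P_c^{\mathcal I\cup\mathcal J}=12\,(1+\|x_{\mathcal I}-x_{\mathcal J}\|^{-1/2})^2$. Let $\Phi(d)=\max(\min(6d^5-15d^4+10d^3,1),0)$. For $\varepsilon>0$ and nodes $\mathcal I,\mathcal J$ of different bodies put $d_1=R_{\mathcal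 I}+R_{\mathcal J}$, $d_2=(1+\varepsilon)d_1$, $\phi=\Phi\big((\|x_{\mathcal I}-x_{\mathcal J}\|-d_1)/(d_2-d_1)\big)$ and, recursively, $$\mathcal P_{\rm BSH}^{\mathcal I\cup\mathcal J}=(1-\phi)\,\mathcal P_{d_1}^{\mathcal I\cup\mathcal J}+\phi\,\mathcal P_c^{\mathcal I\cup\mathcal J},$$ where $\mathcal P_{d_1}^{\mathcal I\cup\mathcal J}$ is $\mathcal P^{s\cup t}$ if the nodes are leaves storing $s$ and $t$, and otherwise $\sum_{\mathcal I_c\in C(\mathcal I)}\sum_{\mathcal J_c\in C(\mathcal J)}\mathcal P_{\rm BSH}^{\mathcal I_c\cup\mathcal J_c}$, with $C(\cdot)$ the two children of an internal node and $C(\mathcal I)=\{\mathcal I\}$ for a leaf. Let $\mathcal P=\sum\mathcal P_{\rm BSH}^{\mathcal I\cup\mathcal J}$, summed over the unordered pairs of root nodes of different bodies. **Theorem.** For every $\varepsilon>0$: (A) $\mathcal P\ge0$ is continuous on $\mathcal C$ as a function into $[0,\infty]$, and for $x\in\mathcal C$, $\mathcal P(x)=\infty$ if and only if $x\in\mathcal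 C_{\rm obs}$. (B) At every $x\in\mathcal C_{\rm free}$, $\mathcal P$ is finite in a neighbourhood of $x$ in $\mathbb R^{3V}$ and twice differentiable at $x$. (C) There is a finite family of pairs of vertex sets $\langle\mathcal I_k,\mathcal J_k\rangle$ and functions $Q_k$ on $\mathbb R^{3V}$ with values in $[0,\infty]$, each depending only on the positions of the vertices in $\mathcal I_k\cup\mathcal J_k$, such that for every $x\in\mathcal C_{\rm free}$ there is a finite subfamily $\mathcal A(x)$ with $\mathcal P=\sum_{k\in\mathcal A(x)}Q_k$ in a neighbourhood of $x$ in $\mathbb R^{3V}$, for which: for each $k\in\mathcal A(x)$, $\mathcal I_k\cap\mathcal J_k=\emptyset$, $\mathrm{CH}(x_{\mathcal I_k})\cap\mathrm{CH}(x_{\mathcal J_k})=\emptyset$, and the forces $f_i=-\partial Q_k/\partial x_i$ at $x$ are all non-zero and satisfy $f_i\in\mathcal F_{\mathcal J_k\to\mathcal I_k}$ for $i\in\mathcal I_k$ and $f_j\in\mathcal F_{\mathcal I_k\to\mathcal J_k}$ for $j\in\mathcal J_k$, where $\mathcal F_{\mathcal J\to\mathcal I}=\{\alpha(a-b):\alpha>0,\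 a\in\mathrm{CH}(x_{\mathcal I}),\ b\in\mathrm{CH}(x_{\mathcal J})\}$; and for all triangles $s,t$ on different bodies there is $k\in\mathcal A(x)$ with $s\cup t\subseteq\mathcal I_k\cup\mathcal J_k$. -/

import Mathlib

open scoped ENNReal Topology

noncomputable section

namespace ContactBSH

/-- Three-dimensional Euclidean space. -/
abbrev E3 : Type := EuclideanSpace ℝ (Fin 3)

/-- Positions of `V` vertices, a point of `ℝ^(3V)`. -/
abbrev Config (V : ℕ) : Type := Fin V → E3

/-- Binary trees whose leaves store one triangle index each. -/
inductive BTree (T : ℕ) : Type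
  | leaf (t : Fin T) : BTree T
  | node (l r : BTree T) : BTree T

/-- The triangle `t` is stored at some leaf of the tree. -/
def BTree.HasLeaf {T : ℕ} (t : Fin T) : BTree T → Prop
  | .leaf s => t = s
  | .node l r => l.HasLeaf t ∨ r.HasLeaf t

/-- Finitely many rigid bodies represented by triangle meshes with pairwise disjoint vertex
sets, in a rest pose, with a binary tree over the triangles of each body and the radii chosen
for the bounding spheres of the single triangles. -/
structure Scene (V T B : ℕ) where
  /-- the three corners of each triangle -/
  corner : Fin T → Fin 3 → Fin V
  corner_injective : ∀ t, Function.Injective (corner t)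
  /-- the body to which a vertex belongs -/
  vertexBody : Fin V → Fin B
  /-- the body to which a triangle belongs -/
  triBody : Fin T → Fin B
  corner_body : ∀ t k, vertexBody (corner t k) = triBody t
  /-- the tree of each body; its leaves store precisely the triangles of that body -/
  tree : Fin B → BTree T
  hasLeaf_tree : ∀ b t, (tree b).HasLeaf t ↔ triBody t = b
  /-- vertex positions in the rest pose, which fix the shape of each body -/
  rest : Config V
  /-- radius of the sphere about the centroid of a triangle -/
  leafRadius : Fin T → ℝ
  leafRadius_pos : ∀ t, 0 < leafRadius t
  leafRadius_bound : ∀ t k,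
    dist (rest (corner t k)) ((3 : ℝ)⁻¹ • ∑ m, rest (corner t m)) ≤ leafRadius t

/-! ### Centers, hulls and configurations -/

/-- The mean `x_I` of the positions of the vertices in `I`. -/
def center {V : ℕ} (x : Config V) (I : Finset (Fin V)) : E3 :=
  (I.card : ℝ)⁻¹ • ∑ i ∈ I, x i

/-- The convex hull of the positions of the vertices in `I` (closed, since `I` is finite). -/
def hull {V : ℕ} (x : Config V) (I : Finset (Fin V)) : Set E3 :=
  convexHull ℝ (x '' (I : Set (Fin V)))

/-- The cone `F_{J → I}` of the vectors `α (a - b)` with `α > 0`, `a` in the hull of `I` and `b`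
in the hull of `J`. -/
def forceCone {V : ℕ} (x : Config V) (J I : Finset (Fin V)) : Set E3 :=
  {v | ∃ α : ℝ, 0 < α ∧ ∃ a ∈ hull x I, ∃ b ∈ hull x J, v = α • (a - b)}

/-- The force `-∂Q/∂x_i` that a potential `Q` exerts on the vertex `i`. -/
def contactForce {V : ℕ} (Q : Config V → ℝ≥0∞) (x : Config V) (i : Fin V) : E3 :=
  - gradient (fun y : E3 => (Q (Function.update x i y)).toReal) (x i)

/-- The potential `Q` between `I` and `J` exerts only non-prehensile forces at `x`. -/
def NonPrehensile {V : ℕ} (Q : Config V → ℝ≥0∞) (I J : Finset (Fin V)) (x : Config V) : Prop :=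
  (∀ i ∈ I, contactForce Q x i ∈ forceCone x J I) ∧
  (∀ j ∈ J, contactForce Q x j ∈ forceCone x I J)

/-- `f` is twice differentiable at `x`. -/
def TwiceDifferentiableAt {V : ℕ} (f : Config V → ℝ) (x : Config V) : Prop :=
  (∀ᶠ y in 𝓝 x, DifferentiableAt ℝ f y) ∧ DifferentiableAt ℝ (fderiv ℝ f) x

/-! ### Building blocks of the potentials -/

/-- The function `1 / max(s, 0)` with values in `[0, ∞]`, equal to `∞` for `s ≤ 0`. -/
def invPos (s : ℝ) : ℝ≥0∞ := (ENNReal.ofReal s)⁻¹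

/-- The centered potential `12 (1 + ‖x_I - x_J‖^(-1/2))²`. -/
def centeredPotential {V : ℕ} (I J : Finset (Fin V)) (x : Config V) : ℝ≥0∞ :=
  12 * (1 + (ENNReal.ofReal √‖center x I - center x J‖)⁻¹) ^ 2

/-- The step function `Φ`. -/
def smoothStep (d : ℝ) : ℝ :=
  max (min (6 * d ^ 5 - 15 * d ^ 4 + 10 * d ^ 3) 1) 0

/-- The interpolation weight `φ_{d₁ → d₂}` between `I` and `J`. -/
def blendWeight {V : ℕ} (d₁ d₂ : ℝ) (I J : Finset (Fin V)) (x : Config V) : ℝ :=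
  smoothStep ((‖center x I - center x J‖ - d₁) / (d₂ - d₁))

/-- The blended potential `(1 - φ) P₁ + φ P₂` in `[0, ∞]`, with `0 * ∞ = 0`. -/
def blend {V : ℕ} (d₁ d₂ : ℝ) (I J : Finset (Fin V)) (P₁ P₂ : ℝ≥0∞) (x : Config V) :
    ℝ≥0∞ :=
  ENNReal.ofReal (1 - blendWeight d₁ d₂ I J x) * P₁
    + ENNReal.ofReal (blendWeight d₁ d₂ I J x) * P₂

namespace Scene

variable {V T B : ℕ} (S : Scene V T B)

/-- The vertex set of a triangle. -/
def triVerts (t : Fin T) : Finset (Fin V) := Finset.univ.image (S.corner t)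

/-- The vertex set of a tree node. -/
def verts : BTree T → Finset (Fin V)
  | .leaf t => S.triVerts t
  | .node l r => verts l ∪ verts r

/-- The radius of a tree node, computed in the rest pose. For an internal node it is the least
radius of a ball about the center of the node that contains the balls of both children. -/
def radius : BTree T → ℝ
  | .leaf t => S.leafRadius t
  | .node l r =>
      max
        (dist (center S.rest (S.verts l)) (center S.rest (S.verts l ∪ S.verts r)) + radius l)
        (dist (center S.rest (S.verts r)) (center S.rest (S.verts l ∪ S.verts r)) + radius r)

/-- The configurations in which every body is congruent to its rest shape. -/
def rigidConfigs : Set (Config V) :=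
  {x | ∀ i j, S.vertexBody i = S.vertexBody j → dist (x i) (x j) = dist (S.rest i) (S.rest j)}

/-- The penetrating configurations in `C`: two triangles of different bodies meet. -/
def obs (C : Set (Config V)) : Set (Config V) :=
  {x | x ∈ C ∧ ∃ s t, S.triBody s ≠ S.triBody t ∧
    (hull x (S.triVerts s) ∩ hull x (S.triVerts t)).Nonempty}

/-- The penetration-free configurations in `C`. -/
def free (C : Set (Config V)) : Set (Config V) := C \ S.obs C

/-! ### The potentials -/

/-- The objective of the plane with normal `n` and offset `d` between triangles `s` and `t`. -/
def planeObjective (s t : Fin T) (n : E3) (d : ℝ) (x : Config V) : ℝ≥0∞ :=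
  12 * invPos (1 - ‖n‖)
    + ∑ k, invPos (inner ℝ (x (S.corner s k)) n + d)
    + ∑ k, invPos (inner ℝ (x (S.corner t k)) (-n) - d)

/-- The exact separating-plane potential between two triangles. -/
def exactPotential (s t : Fin T) (x : Config V) : ℝ≥0∞ :=
  ⨅ p : E3 × ℝ, S.planeObjective s t p.1 p.2 x

/-- The blending of a more accurate value `P₁` with the centered potential for a pair of tree
nodes, with `d₁ = R_I + R_J` and `d₂ = (1 + ε) d₁`. -/
def nodeBlend (ε : ℝ) (I J : BTree T) (P₁ : ℝ≥0∞) (x : Config V) : ℝ≥0∞ :=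
  blend (S.radius I + S.radius J) ((1 + ε) * (S.radius I + S.radius J)) (S.verts I) (S.verts J)
    P₁ (centeredPotential (S.verts I) (S.verts J) x) x

/-- The recursive hierarchical potential of a pair of tree nodes. -/
def nodePotential (ε : ℝ) (x : Config V) : BTree T → BTree T → ℝ≥0∞
  | .leaf s, .leaf t => S.nodeBlend ε (.leaf s) (.leaf t) (S.exactPotential s t x) x
  | .leaf s, .node l r =>
      S.nodeBlend ε (.leaf s) (.node l r)
        (nodePotential ε x (.leaf s) l + nodePotential ε x (.leaf s) r) x
  | .node l r, .leaf t =>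
      S.nodeBlend ε (.node l r) (.leaf t)
        (nodePotential ε x l (.leaf t) + nodePotential ε x r (.leaf t)) x
  | .node l r, .node l' r' =>
      S.nodeBlend ε (.node l r) (.node l' r')
        (nodePotential ε x l l' + nodePotential ε x l r'
          + (nodePotential ε x r l' + nodePotential ε x r r')) x
termination_by I J => sizeOf I + sizeOf J

/-- The hierarchical contact potential: the sum over the unordered pairs of different bodies of
the potential of their root nodes. -/
def potential (ε : ℝ) (x : Config V) : ℝ≥0∞ :=
  ∑ p : Fin B × Fin B with p.1 < p.2, S.nodePotential ε x (S.tree p.1) (S.tree p.2)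

/-! ### The properties of a well-behaved potential -/

/-- Log-barrier property: `P` is nonnegative and continuous on `C` as a function into `[0, ∞]`,
and it is infinite exactly on the penetrating set. -/
def PropertyA (C : Set (Config V)) (P : Config V → ℝ≥0∞) : Prop :=
  (∀ x ∈ C, 0 ≤ P x) ∧ ContinuousOn P C ∧ ∀ x ∈ C, P x = ∞ ↔ x ∈ S.obs C

/-- Smoothness property: near each free configuration `P` is finite, and it is twice
differentiable there as a function of all vertex coordinates. -/
def PropertyB (C : Set (Config V)) (P : Config V → ℝ≥0∞) : Prop :=
  ∀ x ∈ S.free C, (∀ᶠ y in 𝓝 x, P y ≠ ∞) ∧ TwiceDifferentiableAt (fun y => (P y).toReal) x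

/-- Non-prehensile and non-vanishing property: there are finitely many pairwise terms `Q k`, each
a function of the positions of the vertices in `I k ∪ J k`, such that around each free `x` the
potential is the sum of a subfamily of terms between separated vertex clusters, each of which
exerts only non-prehensile, non-zero forces; each pair of triangles on different bodies is covered
by a term of the subfamily. -/
def PropertyC (C : Set (Config V)) (P : Config V → ℝ≥0∞) : Prop :=
  ∃ (ι : Type) (_ : Fintype ι) (I J : ι → Finset (Fin V)) (Q : ι → Config V → ℝ≥0∞),
    (∀ k x y, (∀ i ∈ I k ∪ J k, x i = y i) → Q k x = Q k y) ∧
    ∀ x ∈ S.free C, ∃ A : Finset ι,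
      (∀ k ∈ A, Disjoint (I k) (J k) ∧ Disjoint (hull x (I k)) (hull x (J k)) ∧
        NonPrehensile (Q k) (I k) (J k) x ∧ ∀ i ∈ I k ∪ J k, contactForce (Q k) x i ≠ 0) ∧
      (∀ᶠ y in 𝓝 x, P y = ∑ k ∈ A, Q k y) ∧
      ∀ s t, S.triBody s ≠ S.triBody t → ∃ k ∈ A, S.triVerts s ∪ S.triVerts t ⊆ I k ∪ J k

end Scene

end ContactBSH

end

/-!
The hierarchical potential is analysed by recursion over pairs of tree nodes, from three facts.

*Exact potentials.* The objective of a plane `(n, d)` is continuous with values in `[0, ∞]`, and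
near a given configuration only a compact set of planes matters, so the infimum is continuous; by
the Hahn–Banach theorem it is finite exactly if the triangles are disjoint. Where it is finite, an
optimal plane has `n ≠ 0`, the second derivative of the objective in `(n, d)` is positive definite
there, and the implicit function theorem extends the optimal plane to a `C²` family of stationary
planes (`exists_contDiffAt_stationary`). Stationary planes are optimal by convexity, so the
infimum is of class `C²`. By the envelope theorem the forces on the corners are positive multiples
of `± n`, and stationarity says that `n` points from a point of one triangle to a point of the
other (`Separates.normal_mem_forceCone`).

*Bounding spheres.* In rigid configurations the spheres computed in the rest pose still contain
their vertices and are nested along the tree. If the spheres of two nodes do not overlap, the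
hulls of their vertices are disjoint, or touch in a common vertex since balls are strictly convex
(`disjoint_hull_verts`). Overlap of the spheres of two children is impossible without overlap of
the spheres of their parents.

*Blending.* The weight of the centered potential increases with the distance of the centers, so
its derivative contributes a repulsive force provided that the centered potential is at most the
potential it replaces. For two triangles this is an inequality of Cauchy–Schwarz type
(`Separates.centered_le`). For other pairs of nodes the distance of the centers plus both radii
does not increase on passing to children, which bounds the potentials of the children from below
(`le_nodePotential`). If the spheres do not overlap, that sum is at most `2 D`, there are at least
two pairs of children, and `12 (1 + D^(-1/2))²` is at most twice its value at `2 D`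
(`centeredPotential_le_finePotential`). Hence the potential of such a pair exerts non-prehensile
forces; they do not vanish because the cones of disjoint hulls omit `0`. Where the spheres overlap
strictly, the potential is locally the sum over the pairs of children, and the recursion yields
the decomposition into contact terms (`decomposable_nodePotential`). In `[0, ∞]` the blend is
continuous because the centered potential is finite where its weight is positive, and the finer
potential is finite where the spheres do not overlap.
-/

noncomputable section

namespace ContactBSH

/-! ### The step function -/

theorem hasDerivAt_max_zero_pow (k : ℕ) (d : ℝ) :
    HasDerivAt (fun d : ℝ => max d 0 ^ (k + 2)) ((k + 2 : ℕ) * max d 0 ^ (k + 1)) d := by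
  have key : ∀ y : ℝ, y ≠ 0 →
      HasDerivAt (fun d : ℝ => max d 0 ^ (k + 2)) ((k + 2 : ℕ) * max y 0 ^ (k + 1)) y := by
    intro y hy
    rcases lt_or_gt_of_ne hy with h | h
    · rw [max_eq_right h.le]
      have : (fun d : ℝ => max d 0 ^ (k + 2)) =ᶠ[𝓝 y] fun _ => 0 := by
        filter_upwards [Iio_mem_nhds h] with z (hz : z < 0)
        simp [max_eq_right hz.le]
      simpa using (hasDerivAt_const y (0 : ℝ)).congr_of_eventuallyEq this
    · rw [max_eq_left h.le]
      have : (fun d : ℝ => max d 0 ^ (k + 2)) =ᶠ[𝓝 y] fun d => d ^ (k + 2) := by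
        filter_upwards [Ioi_mem_nhds h] with z (hz : 0 < z)
        simp only [max_eq_left hz.le]
      simpa using (hasDerivAt_pow (k + 2) y).congr_of_eventuallyEq this
  rcases eq_or_ne d 0 with rfl | hd
  · exact hasDerivAt_of_hasDerivAt_of_ne key
      (by fun_prop) (by fun_prop)
  · exact key d hd

theorem contDiff_max_zero_cube : ContDiff ℝ 2 (fun d : ℝ => max d 0 ^ 3) := by
  have h2 : ContDiff ℝ 1 (fun d : ℝ => max d 0 ^ 2) := by
    rw [contDiff_one_iff_deriv]
    refine ⟨fun d => (hasDerivAt_max_zero_pow 0 d).differentiableAt, ?_⟩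
    rw [funext fun d => (hasDerivAt_max_zero_pow 0 d).deriv]
    fun_prop
  rw [show (2 : WithTop ℕ∞) = 1 + 1 by norm_num, contDiff_succ_iff_deriv]
  refine ⟨fun d => (hasDerivAt_max_zero_pow 1 d).differentiableAt, by simp, ?_⟩
  rw [funext fun d => (hasDerivAt_max_zero_pow 1 d).deriv]
  exact contDiff_const.mul h2

theorem monotone_quintic : Monotone fun d : ℝ => 6 * d ^ 5 - 15 * d ^ 4 + 10 * d ^ 3 := by
  refine monotone_of_deriv_nonneg (by fun_prop) fun d => ?_
  have : HasDerivAt (fun d : ℝ => 6 * d ^ 5 - 15 * d ^ 4 + 10 * d ^ 3)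
      (30 * (d * (d - 1)) ^ 2) d := by
    have := (((hasDerivAt_pow 5 d).const_mul 6).sub ((hasDerivAt_pow 4 d).const_mul 15)).add
      ((hasDerivAt_pow 3 d).const_mul 10)
    exact this.congr_deriv (by push_cast; ring)
  rw [this.deriv]
  positivity

theorem smoothStep_nonneg (d : ℝ) : 0 ≤ smoothStep d := le_max_right _ _

theorem smoothStep_le_one (d : ℝ) : smoothStep d ≤ 1 := max_le (min_le_right _ _) zero_le_one

theorem smoothStep_monotone : Monotone smoothStep := fun _ _ h =>
  max_le_max_right 0 (min_le_min_right 1 (monotone_quintic h))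

theorem smoothStep_of_nonpos {d : ℝ} (h : d ≤ 0) : smoothStep d = 0 := by
  have := monotone_quintic h
  norm_num at this
  exact max_eq_right ((min_le_left _ _).trans this)

theorem smoothStep_of_mem {d : ℝ} (h0 : 0 ≤ d) (h1 : d ≤ 1) :
    smoothStep d = 6 * d ^ 5 - 15 * d ^ 4 + 10 * d ^ 3 := by
  have a0 := monotone_quintic h0
  have a1 := monotone_quintic h1
  norm_num at a0 a1
  rw [smoothStep, min_eq_left a1, max_eq_left a0]

theorem smoothStep_of_one_le {d : ℝ} (h : 1 ≤ d) : smoothStep d = 1 := by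
  have := monotone_quintic h
  norm_num at this
  rw [smoothStep, min_eq_right this, max_eq_left zero_le_one]

/-- The step function is a combination of powers of `d₊` and `(d - 1)₊` of degree at least three,
because the quintic `p` satisfies `p d + p (1 - d) = 1`. -/
theorem smoothStep_eq (d : ℝ) :
    smoothStep d = max d 0 ^ 3 * (6 * d ^ 2 - 15 * d + 10)
      - max (d - 1) 0 ^ 3 * (6 * (d - 1) ^ 2 + 15 * (d - 1) + 10) := by
  rcases le_total d 0 with h | h
  · rw [smoothStep_of_nonpos h, max_eq_right h, max_eq_right (by linarith)]
    ring
  rcases le_total d 1 with h' | h'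
  · rw [smoothStep_of_mem h h', max_eq_left h, max_eq_right (by linarith)]
    ring
  · rw [smoothStep_of_one_le h', max_eq_left h, max_eq_left (by linarith)]
    ring

theorem contDiff_smoothStep : ContDiff ℝ 2 smoothStep := by
  rw [funext smoothStep_eq]
  have h1 : ContDiff ℝ 2 (fun d : ℝ => max (d - 1) 0 ^ 3) :=
    contDiff_max_zero_cube.comp (g := fun d : ℝ => max d 0 ^ 3) (f := fun d => d - 1) (by fun_prop)
  exact (contDiff_max_zero_cube.mul (by fun_prop)).sub (h1.mul (by fun_prop))

/-! ### Nondegenerate stationary points depending on a parameter -/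

/-- Let `g (x, p)` be of class `C³` near `z`, stationary in `p` at `z`, with positive second
derivative in every direction of `p`. Then `g (x, ·)` has a stationary point depending on `x`
near `z.1` in a `C²` manner. -/
theorem exists_contDiffAt_stationary {X E : Type*} [NormedAddCommGroup X] [NormedSpace ℝ X]
    [CompleteSpace X] [NormedAddCommGroup E] [NormedSpace ℝ E] [FiniteDimensional ℝ E]
    {g : X × E → ℝ} {z : X × E} (hg : ContDiffAt ℝ 3 g z)
    (h0 : ∀ η, fderiv ℝ g z (0, η) = 0)
    (hpos : ∀ η, η ≠ 0 → ∃ c, 0 < c ∧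
      HasDerivAt (fun t : ℝ => fderiv ℝ g (z + t • (0, η)) (0, η)) c 0) :
    ∃ p : X → E, ContDiffAt ℝ 2 p z.1 ∧ p z.1 = z.2 ∧
      ∀ᶠ x in 𝓝 z.1, ∀ η, fderiv ℝ g (x, p x) (0, η) = 0 := by
  have : CompleteSpace E := FiniteDimensional.complete ℝ E
  set F : X × E → (E →L[ℝ] ℝ) := fun w => (fderiv ℝ g w).comp (.inr ℝ X E) with hF
  have hFc : ContDiffAt ℝ 2 F z := by
    have : ContDiffAt ℝ 2 (fderiv ℝ g) z := hg.fderiv_right (by norm_num)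
    exact this.clm_comp contDiffAt_const
  have hF0 : F z = 0 := by
    ext η
    simpa [hF] using h0 η
  have hFd : HasFDerivAt F (fderiv ℝ F z) z := (hFc.differentiableAt (by norm_num)).hasFDerivAt
  have hinj : Function.Injective (fderiv ℝ F z ∘L .inr ℝ X E) := by
    rw [injective_iff_map_eq_zero]
    intro η hη
    by_contra hne
    obtain ⟨c, hc, hd⟩ := hpos η hne
    have hline : HasDerivAt (fun t : ℝ => z + t • ((0, η) : X × E)) (0, η) 0 := by
      simpa using ((hasDerivAt_id (0 : ℝ)).smul_const ((0, η) : X × E)).const_add z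
    have h1 : HasDerivAt (fun t : ℝ => F (z + t • ((0, η) : X × E))) (fderiv ℝ F z (0, η)) 0 := by
      have := HasFDerivAt.comp_hasDerivAt (x := (0 : ℝ))
        (f := fun t : ℝ => z + t • ((0, η) : X × E))
        (l := F) (l' := fderiv ℝ F z) (by simpa using hFd) hline
      exact this
    have h2 := h1.clm_apply (hasDerivAt_const (0 : ℝ) η)
    have h3 : c = fderiv ℝ F z (0, η) η := by
      refine hd.unique ?_
      simpa [hF, show ((0, 0) : X × E) = 0 from rfl] using h2
    have h4 : fderiv ℝ F z (0, η) = 0 := by simpa using hη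
    rw [h4] at h3
    simp at h3
    exact hc.ne' h3
  -- an injective map from `E` to its dual is invertible, for reasons of dimension
  have hinv : (fderiv ℝ F z ∘L .inr ℝ X E).IsInvertible := by
    have hfr : Module.finrank ℝ E = Module.finrank ℝ (E →L[ℝ] ℝ) := by
      rw [← (LinearMap.toContinuousLinearMap (𝕜 := ℝ) (E := E) (F' := ℝ)).finrank_eq]
      exact (Subspace.dual_finrank_eq (K := ℝ) (V := E)).symm
    let e := LinearEquiv.ofInjectiveOfFinrankEq
      (fderiv ℝ F z ∘L .inr ℝ X E : E →L[ℝ] (E →L[ℝ] ℝ)).toLinearMap hinj hfr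
    exact ⟨e.toContinuousLinearEquiv, by ext; rfl⟩
  refine ⟨hFc.implicitFunction (by norm_num) hinv, hFc.contDiffAt_implicitFunction _ hinv,
    hFc.implicitFunction_apply_self _ hinv, ?_⟩
  filter_upwards [hFc.eventually_apply_implicitFunction (by norm_num) hinv] with x hx η
  rw [hF0] at hx
  simpa [hF] using congrArg (fun L : E →L[ℝ] ℝ => L η) hx

/-! ### Hulls, cones and bounding balls -/

section Geometry

variable {V : ℕ} {x : Config V} {I J : Finset (Fin V)}

theorem sum_smul_mem_hull {ι : Type*} [Fintype ι] {w : ι → ℝ} {c : ι → Fin V}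
    (hw : ∀ k, 0 ≤ w k) (hw1 : ∑ k, w k = 1) (hc : ∀ k, c k ∈ I) :
    ∑ k, w k • x (c k) ∈ hull x I :=
  (convex_convexHull ℝ _).sum_mem (fun k _ => hw k) hw1
    fun k _ => subset_convexHull ℝ _ ⟨c k, hc k, rfl⟩

theorem center_mem_hull (hI : I.Nonempty) : center x I ∈ hull x I := by
  have h : (I.card : ℝ) ≠ 0 := by simpa using hI.ne_empty
  rw [center, Finset.smul_sum]
  exact (convex_convexHull ℝ _).sum_mem (fun _ _ => by positivity)
    (by rw [Finset.sum_const, nsmul_eq_mul, mul_inv_cancel₀ h])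
    fun i hi => subset_convexHull ℝ _ ⟨i, hi, rfl⟩

theorem hull_mono {I' : Finset (Fin V)} (h : I ⊆ I') : hull x I ⊆ hull x I' :=
  convexHull_mono (Set.image_mono (by exact_mod_cast h))

theorem isCompact_hull (x : Config V) (I : Finset (Fin V)) : IsCompact (hull x I) :=
  (I.finite_toSet.image x).isCompact_convexHull ℝ

theorem forceCone_mono {I' J' : Finset (Fin V)} (hI : I ⊆ I') (hJ : J ⊆ J') :
    forceCone x J I ⊆ forceCone x J' I' := by
  rintro _ ⟨α, hα, a, ha, b, hb, rfl⟩
  exact ⟨α, hα, a, hull_mono hI ha, b, hull_mono hJ hb, rfl⟩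

theorem smul_mem_forceCone {v : E3} {α : ℝ} (hα : 0 < α) (hv : v ∈ forceCone x J I) :
    α • v ∈ forceCone x J I := by
  obtain ⟨β, hβ, a, ha, b, hb, rfl⟩ := hv
  exact ⟨α * β, mul_pos hα hβ, a, ha, b, hb, smul_smul _ _ _⟩

theorem neg_mem_forceCone {v : E3} (hv : v ∈ forceCone x J I) : -v ∈ forceCone x I J := by
  obtain ⟨β, hβ, a, ha, b, hb, rfl⟩ := hv
  exact ⟨β, hβ, b, hb, a, ha, by rw [← smul_neg, neg_sub]⟩

theorem add_mem_forceCone {v w : E3} (hv : v ∈ forceCone x J I) (hw : w ∈ forceCone x J I) :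
    v + w ∈ forceCone x J I := by
  obtain ⟨α, hα, a, ha, b, hb, rfl⟩ := hv
  obtain ⟨β, hβ, a', ha', b', hb', rfl⟩ := hw
  have hs : 0 < α + β := by positivity
  have h1 : α / (α + β) + β / (α + β) = 1 := by field_simp
  refine ⟨α + β, hs, (α / (α + β)) • a + (β / (α + β)) • a',
    convex_convexHull ℝ _ ha ha' (by positivity) (by positivity) h1,
    (α / (α + β)) • b + (β / (α + β)) • b',
    convex_convexHull ℝ _ hb hb' (by positivity) (by positivity) h1, ?_⟩
  have e1 : (α + β) * (α / (α + β)) = α := by field_simp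
  have e2 : (α + β) * (β / (α + β)) = β := by field_simp
  simp only [smul_sub, smul_add, smul_smul, e1, e2]
  abel

theorem zero_notMem_forceCone (h : Disjoint (hull x I) (hull x J)) :
    (0 : E3) ∉ forceCone x J I := by
  rintro ⟨α, hα, a, ha, b, hb, h0⟩
  have : a = b := by simpa [hα.ne', sub_eq_zero] using h0.symm
  exact Set.disjoint_left.1 h ha (this ▸ hb)

/-- Congruent vertex sets have congruent centers. -/
theorem dist_center_eq {x y : Config V} {U I J : Finset (Fin V)}
    (h : ∀ i ∈ U, ∀ j ∈ U, dist (x i) (x j) = dist (y i) (y j))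
    (hIU : I ⊆ U) (hJU : J ⊆ U) (hI : I.Nonempty) (hJ : J.Nonempty) :
    dist (center x I) (center x J) = dist (center y I) (center y J) := by
  classical
  have hw : ∀ {K : Finset (Fin V)}, K ⊆ U → K.Nonempty →
      ∑ i ∈ U, (if i ∈ K then (K.card : ℝ)⁻¹ else 0) = 1 := by
    intro K hK hK0
    have h : (K.card : ℝ) ≠ 0 := by simpa using hK0.ne_empty
    rw [← Finset.sum_filter, Finset.filter_mem_eq_inter, Finset.inter_eq_right.2 hK,
      Finset.sum_const, nsmul_eq_mul, mul_inv_cancel₀ h]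
  have hc : ∀ (z : Config V) {K : Finset (Fin V)} (_ : K ⊆ U) (_ : K.Nonempty), center z K =
      U.affineCombination ℝ z (fun i => if i ∈ K then (K.card : ℝ)⁻¹ else 0) := by
    intro z K hK hK0
    rw [Finset.affineCombination_eq_linear_combination _ _ _ (hw hK hK0), center,
      Finset.smul_sum]
    simp only [ite_smul, zero_smul]
    rw [← Finset.sum_filter, Finset.filter_mem_eq_inter, Finset.inter_eq_right.2 hK]
  have ex := EuclideanGeometry.dist_affineCombination x (hw hIU hI) (hw hJU hJ)
  have ey := EuclideanGeometry.dist_affineCombination y (hw hIU hI) (hw hJU hJ)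
  have hsq : dist (center x I) (center x J) * dist (center x I) (center x J) =
      dist (center y I) (center y J) * dist (center y I) (center y J) := by
    rw [hc x hIU hI, hc x hJU hJ, hc y hIU hI, hc y hJU hJ]
    refine ex.trans (Eq.trans ?_ ey.symm)
    congr 2
    refine Finset.sum_congr rfl fun i hi => Finset.sum_congr rfl fun j hj => ?_
    rw [h i hi j hj]
  exact (mul_self_inj dist_nonneg dist_nonneg).1 hsq

theorem center_singleton (x : Config V) (i : Fin V) : center x {i} = x i := by simp [center]

theorem hull_subset_closedBall {c : E3} {R : ℝ} (h : ∀ i ∈ I, dist (x i) c ≤ R) :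
    hull x I ⊆ Metric.closedBall c R :=
  convexHull_min (by rintro _ ⟨i, hi, rfl⟩; exact h i hi) (convex_closedBall _ _)

/-- A ball is strictly convex, so its boundary points in a hull inside the ball are vertices. -/
theorem exists_eq_of_mem_hull_of_dist_eq {c q : E3} {R : ℝ} (h : ∀ i ∈ I, dist (x i) c ≤ R)
    (hq : q ∈ hull x I) (hR : dist q c = R) : ∃ i ∈ I, x i = q := by
  by_contra! hne
  -- by the Cauchy–Schwarz inequality all vertices lie strictly below the tangent plane at `q`
  have hsub : hull x I ⊆ {y | innerSL ℝ (q - c) y < R ^ 2 + inner ℝ (q - c) c} := by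
    refine convexHull_min ?_ (convex_halfSpace_lt (innerSL ℝ (q - c)).isLinear _)
    rintro _ ⟨i, hi, rfl⟩
    have h1 : ‖x i - c‖ ^ 2 ≤ R ^ 2 := by
      rw [← dist_eq_norm]
      exact pow_le_pow_left₀ dist_nonneg (h i hi) 2
    have h2 : ‖q - c‖ ^ 2 = R ^ 2 := by rw [← dist_eq_norm, hR]
    have h3 : 0 < ‖(q - c) - (x i - c)‖ ^ 2 := by
      have : (q - c) - (x i - c) ≠ 0 := by
        rw [sub_sub_sub_cancel_right, sub_ne_zero]
        exact (hne i hi).symm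
      positivity
    rw [norm_sub_sq_real] at h3
    have h4 : inner ℝ (q - c) (x i - c) = inner ℝ (q - c) (x i) - inner ℝ (q - c) c :=
      inner_sub_right _ _ _
    simp only [Set.mem_ofPred_eq, innerSL_apply_apply]
    linarith
  have h5 := hsub hq
  have h6 : inner ℝ (q - c) (q - c) = inner ℝ (q - c) q - inner ℝ (q - c) c := inner_sub_right _ _ _
  rw [real_inner_self_eq_norm_sq, ← dist_eq_norm, hR] at h6
  simp only [Set.mem_ofPred_eq, innerSL_apply_apply] at h5
  linarith

/-- Hulls inside two balls without common interior points meet only where vertices coincide. -/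
theorem exists_eq_of_hull_inter_hull {c c' : E3} {R R' : ℝ} (h : ∀ i ∈ I, dist (x i) c ≤ R)
    (h' : ∀ j ∈ J, dist (x j) c' ≤ R') (hc : R + R' ≤ dist c c')
    (hne : (hull x I ∩ hull x J).Nonempty) : ∃ i ∈ I, ∃ j ∈ J, x i = x j := by
  obtain ⟨q, hqI, hqJ⟩ := hne
  have h1 : dist q c ≤ R := hull_subset_closedBall h hqI
  have h2 : dist q c' ≤ R' := hull_subset_closedBall h' hqJ
  have h3 := dist_triangle_left c c' q
  obtain ⟨i, hi, hiq⟩ := exists_eq_of_mem_hull_of_dist_eq h hqI (by linarith)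
  obtain ⟨j, hj, hjq⟩ := exists_eq_of_mem_hull_of_dist_eq h' hqJ (by linarith)
  exact ⟨i, hi, j, hj, hiq.trans hjq.symm⟩

end Geometry

/-! ### Regular potentials and their forces -/

section Forces

variable {V : ℕ} {x : Config V} {I J : Finset (Fin V)} {Q Q₁ Q₂ : Config V → ℝ≥0∞}

/-- The potential `Q` is finite near `x` and of class `C²` at `x`. -/
def Regular (Q : Config V → ℝ≥0∞) (x : Config V) : Prop :=
  (∀ᶠ y in 𝓝 x, Q y ≠ ∞) ∧ ContDiffAt ℝ 2 (fun y => (Q y).toReal) x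

theorem Regular.ne_top (h : Regular Q x) : Q x ≠ ∞ := h.1.self_of_nhds

theorem Regular.differentiableAt (h : Regular Q x) :
    DifferentiableAt ℝ (fun y => (Q y).toReal) x := h.2.differentiableAt (by norm_num)

theorem Regular.twiceDifferentiableAt (h : Regular Q x) :
    TwiceDifferentiableAt (fun y => (Q y).toReal) x := by
  refine ⟨?_, ?_⟩
  · filter_upwards [h.2.eventually (by simp)] with y hy
    exact hy.differentiableAt (by norm_num)
  · exact (h.2.fderiv_right (m := 1) (by norm_num)).differentiableAt (by norm_num)

theorem Regular.congr (h : Regular Q₁ x) (he : Q₂ =ᶠ[𝓝 x] Q₁) : Regular Q₂ x := by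
  refine ⟨?_, h.2.congr_of_eventuallyEq ?_⟩
  · filter_upwards [h.1, he] with y hy hy'
    rwa [hy']
  · filter_upwards [he] with y hy
    simp [hy]

theorem regular_zero : Regular (fun _ => 0) x := ⟨by simp, contDiffAt_const⟩

theorem Regular.toReal_add (h₁ : Regular Q₁ x) (h₂ : Regular Q₂ x) :
    (fun y => (Q₁ y + Q₂ y).toReal) =ᶠ[𝓝 x] fun y => (Q₁ y).toReal + (Q₂ y).toReal := by
  filter_upwards [h₁.1, h₂.1] with y h1 h2
  exact ENNReal.toReal_add h1 h2

theorem Regular.add (h₁ : Regular Q₁ x) (h₂ : Regular Q₂ x) :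
    Regular (fun y => Q₁ y + Q₂ y) x := by
  refine ⟨?_, (h₁.2.add h₂.2).congr_of_eventuallyEq (h₁.toReal_add h₂)⟩
  filter_upwards [h₁.1, h₂.1] with y h1 h2
  exact ENNReal.add_ne_top.2 ⟨h1, h2⟩

theorem regular_sum {ι : Type*} {s : Finset ι} {Q : ι → Config V → ℝ≥0∞}
    (h : ∀ k ∈ s, Regular (Q k) x) : Regular (fun y => ∑ k ∈ s, Q k y) x := by
  classical
  induction s using Finset.induction_on with
  | empty => simpa using regular_zero
  | insert k s hk ih =>
    simp only [Finset.sum_insert hk]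
    exact (h k (by simp)).add (ih fun l hl => h l (by simp [hl]))

theorem inner_contactForce (h : DifferentiableAt ℝ (fun y => (Q y).toReal) x) (i : Fin V)
    (v : E3) : inner ℝ (contactForce Q x i) v =
      - fderiv ℝ (fun y => (Q y).toReal) x (Pi.single i v) := by
  have hu := hasFDerivAt_update (𝕜 := ℝ) (E := fun _ : Fin V => E3) x (i := i) (x i)
  have h' : HasFDerivAt (fun y => (Q y).toReal) (fderiv ℝ (fun y => (Q y).toReal) x)
      (Function.update x i (x i)) := by
    rw [Function.update_eq_self]
    exact h.hasFDerivAt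
  have hc := h'.comp (x i) hu
  have hg : contactForce Q x i = - (InnerProductSpace.toDual ℝ E3).symm _ :=
    congrArg Neg.neg (hasFDerivAt_iff_hasGradientAt.1 hc).gradient
  rw [hg, inner_neg_left, InnerProductSpace.toDual_symm_apply]
  have hs : (ContinuousLinearMap.pi (Pi.single i (.id ℝ E3)) : E3 →L[ℝ] Config V) v
      = Pi.single i v := by
    ext1 j
    rcases eq_or_ne j i with rfl | hj
    · simp
    · simp [hj]
  rw [ContinuousLinearMap.comp_apply, hs]

theorem contactForce_eq_of_fderiv (h : DifferentiableAt ℝ (fun y => (Q y).toReal) x) {i : Fin V}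
    {w : E3} (hw : ∀ v, fderiv ℝ (fun y => (Q y).toReal) x (Pi.single i v) = - inner ℝ w v) :
    contactForce Q x i = w :=
  ext_inner_right ℝ fun v => by rw [inner_contactForce h, hw, neg_neg]

theorem contactForce_add (h₁ : Regular Q₁ x) (h₂ : Regular Q₂ x) (i : Fin V) :
    contactForce (fun y => Q₁ y + Q₂ y) x i = contactForce Q₁ x i + contactForce Q₂ x i := by
  refine contactForce_eq_of_fderiv (h₁.add h₂).differentiableAt fun v => ?_
  rw [(h₁.toReal_add h₂).fderiv_eq, fderiv_fun_add h₁.differentiableAt h₂.differentiableAt,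
    inner_add_left, inner_contactForce h₁.differentiableAt, inner_contactForce h₂.differentiableAt,
    add_apply]
  ring

theorem contactForce_eq_zero_of_dependsOn {U : Finset (Fin V)} (h : DependsOn Q (U : Set (Fin V)))
    {i : Fin V} (hi : i ∉ U) : contactForce Q x i = 0 := by
  have : (fun y : E3 => (Q (Function.update x i y)).toReal) = fun _ => (Q x).toReal := by
    funext y
    rw [h (x := Function.update x i y) (y := x) fun j hj => Function.update_of_ne
      (by rintro rfl; exact hi hj) _ _]
  rw [contactForce, this]
  simp [gradient]

theorem dependsOn_add {I₁ I₂ J₁ J₂ : Finset (Fin V)}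
    (h₁ : DependsOn Q₁ ((I₁ ∪ J₁ : Finset (Fin V)) : Set (Fin V)))
    (h₂ : DependsOn Q₂ ((I₂ ∪ J₂ : Finset (Fin V)) : Set (Fin V))) :
    DependsOn (fun y => Q₁ y + Q₂ y)
      (((I₁ ∪ I₂) ∪ (J₁ ∪ J₂) : Finset (Fin V)) : Set (Fin V)) := fun _ _ h =>
  congrArg₂ (· + ·)
    (h₁ fun i hi => h i
      (Finset.union_subset_union Finset.subset_union_left Finset.subset_union_left hi))
    (h₂ fun i hi => h i
      (Finset.union_subset_union Finset.subset_union_right Finset.subset_union_right hi))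

/-- Forces add, and the cones are convex. A vertex on which only one of the two potentials depends
feels only the force of that one. -/
theorem NonPrehensile.add {I₁ I₂ J₁ J₂ : Finset (Fin V)} (h₁ : NonPrehensile Q₁ I₁ J₁ x)
    (h₂ : NonPrehensile Q₂ I₂ J₂ x) (r₁ : Regular Q₁ x) (r₂ : Regular Q₂ x)
    (l₁ : DependsOn Q₁ ((I₁ ∪ J₁ : Finset (Fin V)) : Set (Fin V)))
    (l₂ : DependsOn Q₂ ((I₂ ∪ J₂ : Finset (Fin V)) : Set (Fin V)))
    (hd : Disjoint (I₁ ∪ I₂) (J₁ ∪ J₂)) :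
    NonPrehensile (fun y => Q₁ y + Q₂ y) (I₁ ∪ I₂) (J₁ ∪ J₂) x := by
  have aux : ∀ {K₁ K₂ L₁ L₂ : Finset (Fin V)}, Disjoint (K₁ ∪ K₂) (L₁ ∪ L₂) →
      (∀ i ∈ K₁, contactForce Q₁ x i ∈ forceCone x L₁ K₁) →
      (∀ i ∈ K₂, contactForce Q₂ x i ∈ forceCone x L₂ K₂) →
      (∀ i ∉ K₁ ∪ L₁, contactForce Q₁ x i = 0) → (∀ i ∉ K₂ ∪ L₂, contactForce Q₂ x i = 0) →
      ∀ i ∈ K₁ ∪ K₂, contactForce (fun y => Q₁ y + Q₂ y) x i ∈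
        forceCone x (L₁ ∪ L₂) (K₁ ∪ K₂) := by
    intro K₁ K₂ L₁ L₂ hd f₁ f₂ z₁ z₂ i hi
    rw [contactForce_add r₁ r₂]
    have hL := Finset.disjoint_left.1 hd hi
    simp only [Finset.mem_union, not_or] at hL
    have m₁ : forceCone x L₁ K₁ ⊆ forceCone x (L₁ ∪ L₂) (K₁ ∪ K₂) :=
      forceCone_mono Finset.subset_union_left Finset.subset_union_left
    have m₂ : forceCone x L₂ K₂ ⊆ forceCone x (L₁ ∪ L₂) (K₁ ∪ K₂) :=
      forceCone_mono Finset.subset_union_right Finset.subset_union_right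
    by_cases h1 : i ∈ K₁ <;> by_cases h2 : i ∈ K₂
    · exact add_mem_forceCone (m₁ (f₁ i h1)) (m₂ (f₂ i h2))
    · rw [z₂ i (by simp [h2, hL.2]), add_zero]
      exact m₁ (f₁ i h1)
    · rw [z₁ i (by simp [h1, hL.1]), zero_add]
      exact m₂ (f₂ i h2)
    · simp [h1, h2] at hi
  refine ⟨aux hd h₁.1 h₂.1 (fun i hi => contactForce_eq_zero_of_dependsOn l₁ hi)
      (fun i hi => contactForce_eq_zero_of_dependsOn l₂ hi),
    aux hd.symm h₁.2 h₂.2 (fun i hi => contactForce_eq_zero_of_dependsOn l₁ ?_)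
      (fun i hi => contactForce_eq_zero_of_dependsOn l₂ ?_)⟩
  all_goals rwa [Finset.union_comm]

theorem NonPrehensile.contactForce_ne_zero (h : NonPrehensile Q I J x)
    (hd : Disjoint (hull x I) (hull x J)) {i : Fin V} (hi : i ∈ I ∪ J) :
    contactForce Q x i ≠ 0 := by
  intro h0
  rcases Finset.mem_union.1 hi with hi | hi
  · exact zero_notMem_forceCone hd (h0 ▸ h.1 i hi)
  · exact zero_notMem_forceCone hd.symm (h0 ▸ h.2 i hi)

end Forces

/-! ### Derivative of the norm and a tangent inequality -/

theorem hasFDerivAt_norm_of_ne_zero {E : Type*} [NormedAddCommGroup E] [InnerProductSpace ℝ E]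
    {a : E} (ha : a ≠ 0) : HasFDerivAt (fun y : E => ‖y‖) (‖a‖⁻¹ • innerSL ℝ a) a := by
  have hn : ‖a‖ ≠ 0 := norm_ne_zero_iff.2 ha
  have h1 : HasFDerivAt (fun y : E => ‖y‖) (fderiv ℝ (fun y : E => ‖y‖) a) a :=
    (differentiableAt_id.norm ℝ ha).hasFDerivAt
  have h2 := (h1.pow 2).unique ((hasStrictFDerivAt_norm_sq a).hasFDerivAt)
  convert h1 using 1
  ext v
  have h3 := congrArg (fun L : E →L[ℝ] ℝ => L v) h2
  simp at h3
  simp only [smul_apply, innerSL_apply_apply, smul_eq_mul]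
  field_simp
  linarith

theorem hasDerivAt_norm_line {E : Type*} [NormedAddCommGroup E] [InnerProductSpace ℝ E]
    {n v : E} {r : ℝ} (h : n + r • v ≠ 0) :
    HasDerivAt (fun r : ℝ => ‖n + r • v‖) (inner ℝ (n + r • v) v / ‖n + r • v‖) r := by
  have hl : HasDerivAt (fun r : ℝ => n + r • v) v r := by
    simpa using ((hasDerivAt_id r).smul_const v).const_add n
  refine ((hasFDerivAt_norm_of_ne_zero h).comp_hasDerivAt r hl).congr_deriv ?_
  rw [smul_apply, innerSL_apply_apply, smul_eq_mul, div_eq_inv_mul]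

theorem inv_add_deriv_le_inv {a b : ℝ} (ha : 0 < a) (hb : 0 < b) :
    a⁻¹ - (b - a) / a ^ 2 ≤ b⁻¹ := by
  have e : b⁻¹ - (a⁻¹ - (b - a) / a ^ 2) = (b - a) ^ 2 / (a ^ 2 * b) := by
    field_simp
    ring
  have : 0 ≤ (b - a) ^ 2 / (a ^ 2 * b) := by positivity
  linarith

/-! ### The centered potential and blending -/

section Blend

variable {V : ℕ} {x : Config V} {I J : Finset (Fin V)} {P₁ : Config V → ℝ≥0∞} {d₁ d₂ : ℝ}

/-- The difference of the centers of `I` and `J` as a linear map. -/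
def centerDiff (I J : Finset (Fin V)) : Config V →L[ℝ] E3 :=
  (I.card : ℝ)⁻¹ • ∑ i ∈ I, ContinuousLinearMap.proj i
    - (J.card : ℝ)⁻¹ • ∑ j ∈ J, ContinuousLinearMap.proj j

theorem centerDiff_apply (x : Config V) : centerDiff I J x = center x I - center x J := by
  simp [centerDiff, center, sum_apply]

theorem centerDiff_single_left (hd : Disjoint I J) {i : Fin V} (hi : i ∈ I) (v : E3) :
    centerDiff I J (Pi.single i v) = (I.card : ℝ)⁻¹ • v := by
  have hJ : i ∉ J := Finset.disjoint_left.1 hd hi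
  simp [centerDiff_apply, center, hi, hJ]

theorem centerDiff_single_right (hd : Disjoint I J) {j : Fin V} (hj : j ∈ J) (v : E3) :
    centerDiff I J (Pi.single j v) = -((J.card : ℝ)⁻¹ • v) := by
  have hI : j ∉ I := Finset.disjoint_right.1 hd hj
  simp [centerDiff_apply, center, hj, hI]

theorem continuous_norm_center_sub (I J : Finset (Fin V)) :
    Continuous fun y : Config V => ‖center y I - center y J‖ := by
  simp only [← centerDiff_apply]
  fun_prop

/-- The centered potential at distance `D`, for `D > 0`. -/
def centeredReal (D : ℝ) : ℝ := 12 * (1 + (√D)⁻¹) ^ 2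

theorem centeredReal_antitone {D D' : ℝ} (hD : 0 < D) (h : D ≤ D') :
    centeredReal D' ≤ centeredReal D := by
  unfold centeredReal
  gcongr

theorem exists_hasDerivAt_centeredReal {D : ℝ} (hD : 0 < D) :
    ∃ c < 0, HasDerivAt centeredReal c D := by
  have hs := Real.sqrt_pos.2 hD
  have h := ((((Real.hasDerivAt_sqrt hD.ne').inv hs.ne').const_add 1).pow 2).const_mul 12
  refine ⟨_, ?_, h⟩
  have : 0 < 1 / (2 * √D) / √D ^ 2 := by positivity
  have h2 : 0 < 1 + (√D)⁻¹ := by positivity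
  have h3 := mul_pos h2 this
  rw [neg_div]
  simp only [Pi.inv_apply]
  norm_num at h3 ⊢
  linarith

theorem contDiffAt_centeredReal {D : ℝ} (hD : 0 < D) : ContDiffAt ℝ 2 centeredReal D := by
  have h := ((Real.contDiffAt_sqrt (n := 2) hD.ne').inv (Real.sqrt_pos.2 hD).ne')
  exact contDiffAt_const.mul ((contDiffAt_const.add h).pow 2)

theorem centeredPotential_eq (h : 0 < ‖center x I - center x J‖) :
    centeredPotential I J x = ENNReal.ofReal (centeredReal ‖center x I - center x J‖) := by
  rw [centeredPotential, centeredReal, ENNReal.ofReal_mul (by norm_num),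
    ENNReal.ofReal_pow (by positivity), ENNReal.ofReal_add (by norm_num) (by positivity),
    ENNReal.ofReal_inv_of_pos (Real.sqrt_pos.2 h)]
  simp

theorem continuous_centeredPotential : Continuous (centeredPotential I J) := by
  have h : Continuous fun y : Config V => (ENNReal.ofReal √‖center y I - center y J‖)⁻¹ :=
    continuous_inv.comp (ENNReal.continuous_ofReal.comp
      (Real.continuous_sqrt.comp (continuous_norm_center_sub I J)))
  exact (ENNReal.continuous_const_mul (by norm_num)).comp
    ((ENNReal.continuous_pow 2).comp (continuous_const.add h))

theorem blendWeight_nonneg : 0 ≤ blendWeight d₁ d₂ I J x := smoothStep_nonneg _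

theorem blendWeight_le_one : blendWeight d₁ d₂ I J x ≤ 1 := smoothStep_le_one _

theorem blendWeight_eq_zero (h : d₁ < d₂) (hD : ‖center x I - center x J‖ ≤ d₁) :
    blendWeight d₁ d₂ I J x = 0 :=
  smoothStep_of_nonpos (div_nonpos_of_nonpos_of_nonneg (by linarith) (by linarith))

theorem lt_of_blendWeight_ne_zero (h : d₁ < d₂) (hφ : blendWeight d₁ d₂ I J x ≠ 0) :
    d₁ < ‖center x I - center x J‖ := by
  by_contra! hD
  exact hφ (blendWeight_eq_zero h hD)

theorem continuous_blendWeight : Continuous (blendWeight d₁ d₂ I J) :=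
  contDiff_smoothStep.continuous.comp
    (((continuous_norm_center_sub I J).sub continuous_const).div_const _)

theorem blend_eq_left (h : d₁ < d₂) (hD : ‖center x I - center x J‖ ≤ d₁) (p q : ℝ≥0∞) :
    blend d₁ d₂ I J p q x = p := by
  simp [blend, blendWeight_eq_zero h hD]

/-- Blending with the centered potential. -/
abbrev centeredBlend (d₁ d₂ : ℝ) (I J : Finset (Fin V)) (P₁ : Config V → ℝ≥0∞) (x : Config V) :
    ℝ≥0∞ :=
  blend d₁ d₂ I J (P₁ x) (centeredPotential I J x) x

theorem centeredBlend_eq_top_iff (h₁ : 0 < d₁) (h : d₁ < d₂) :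
    centeredBlend d₁ d₂ I J P₁ x = ∞ ↔ blendWeight d₁ d₂ I J x ≠ 1 ∧ P₁ x = ∞ := by
  have hc : ENNReal.ofReal (blendWeight d₁ d₂ I J x) * centeredPotential I J x ≠ ∞ := by
    by_cases hφ : blendWeight d₁ d₂ I J x = 0
    · simp [hφ]
    · rw [centeredPotential_eq (h₁.trans (lt_of_blendWeight_ne_zero h hφ))]
      exact ENNReal.mul_ne_top ENNReal.ofReal_ne_top ENNReal.ofReal_ne_top
  have h1 := blendWeight_le_one (d₁ := d₁) (d₂ := d₂) (I := I) (J := J) (x := x)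
  rw [centeredBlend, blend, ENNReal.add_eq_top, or_iff_left hc, ENNReal.mul_eq_top]
  simp only [ENNReal.ofReal_ne_top, false_and, or_false, ne_eq, ENNReal.ofReal_eq_zero, not_le,
    sub_pos]
  rw [lt_iff_le_and_ne, and_iff_right h1, ne_eq]

theorem le_centeredBlend {a : ℝ≥0∞} (h₁ : a ≤ P₁ x) (h₂ : a ≤ centeredPotential I J x) :
    a ≤ centeredBlend d₁ d₂ I J P₁ x := by
  have h : ENNReal.ofReal (1 - blendWeight d₁ d₂ I J x)
      + ENNReal.ofReal (blendWeight d₁ d₂ I J x) = 1 := by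
    rw [← ENNReal.ofReal_add (sub_nonneg.2 blendWeight_le_one) blendWeight_nonneg]
    simp
  calc a = (ENNReal.ofReal (1 - blendWeight d₁ d₂ I J x)
      + ENNReal.ofReal (blendWeight d₁ d₂ I J x)) * a := by rw [h, one_mul]
    _ ≤ _ := by
      rw [add_mul, centeredBlend, blend]
      gcongr

/-- Continuity of the blend. The products `0 * ∞` cause no harm: the centered potential is finite
where its weight is positive, and `P₁` is finite where its weight may vanish. -/
theorem continuousWithinAt_centeredBlend {s : Set (Config V)} (h₁ : 0 < d₁) (h : d₁ < d₂)
    (hP : ContinuousWithinAt P₁ s x) (hfin : d₁ < ‖center x I - center x J‖ → P₁ x ≠ ∞) :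
    ContinuousWithinAt (centeredBlend d₁ d₂ I J P₁) s x := by
  have hD := (continuous_norm_center_sub I J).continuousAt (x := x)
  rcases lt_or_ge ‖center x I - center x J‖ d₁ with hlt | hge
  · have he : centeredBlend d₁ d₂ I J P₁ =ᶠ[𝓝 x] P₁ := by
      filter_upwards [hD.eventually_lt continuousAt_const hlt] with y hy
      exact blend_eq_left h hy.le _ _
    exact hP.congr_of_eventuallyEq (he.filter_mono nhdsWithin_le_nhds) he.self_of_nhds
  · have hw : Continuous (blendWeight d₁ d₂ I J) := continuous_blendWeight
    refine ContinuousWithinAt.add ?_ ?_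
    · refine ENNReal.Tendsto.mul
        (ENNReal.continuous_ofReal.comp (continuous_const.sub hw)).continuousWithinAt ?_ hP
        (Or.inr ENNReal.ofReal_ne_top)
      rcases hge.eq_or_lt with heq | hlt
      · left
        simp [blendWeight_eq_zero h heq.ge]
      · exact Or.inr (hfin hlt)
    · refine ENNReal.Tendsto.mul (ENNReal.continuous_ofReal.comp hw).continuousWithinAt
        (Or.inr ?_) continuous_centeredPotential.continuousWithinAt (Or.inr ENNReal.ofReal_ne_top)
      rw [centeredPotential_eq (h₁.trans_le hge)]
      exact ENNReal.ofReal_ne_top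

theorem toReal_centeredBlend (hD : 0 < ‖center x I - center x J‖) (hP : P₁ x ≠ ∞) :
    (centeredBlend d₁ d₂ I J P₁ x).toReal =
      (1 - smoothStep ((‖centerDiff I J x‖ - d₁) / (d₂ - d₁))) * (P₁ x).toReal
        + smoothStep ((‖centerDiff I J x‖ - d₁) / (d₂ - d₁)) * centeredReal ‖centerDiff I J x‖ := by
  have hc : 0 ≤ centeredReal ‖center x I - center x J‖ := by unfold centeredReal; positivity
  rw [centeredBlend, blend, centeredPotential_eq hD, ENNReal.toReal_add
    (ENNReal.mul_ne_top ENNReal.ofReal_ne_top hP)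
    (ENNReal.mul_ne_top ENNReal.ofReal_ne_top ENNReal.ofReal_ne_top), ENNReal.toReal_mul,
    ENNReal.toReal_mul, ENNReal.toReal_ofReal (sub_nonneg.2 blendWeight_le_one),
    ENNReal.toReal_ofReal blendWeight_nonneg, ENNReal.toReal_ofReal hc, centerDiff_apply]
  rfl

theorem Regular.toReal_centeredBlend (hP : Regular P₁ x) (hD : 0 < ‖center x I - center x J‖) :
    (fun y => (centeredBlend d₁ d₂ I J P₁ y).toReal) =ᶠ[𝓝 x] fun y =>
      (1 - smoothStep ((‖centerDiff I J y‖ - d₁) / (d₂ - d₁))) * (P₁ y).toReal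
        + smoothStep ((‖centerDiff I J y‖ - d₁) / (d₂ - d₁)) * centeredReal ‖centerDiff I J y‖ := by
  filter_upwards [hP.1, continuousAt_const.eventually_lt
    (continuous_norm_center_sub I J).continuousAt hD] with y hy hy'
  exact ContactBSH.toReal_centeredBlend hy' hy

theorem Regular.centeredBlend (hP : Regular P₁ x) (h₁ : 0 < d₁) (h : d₁ < d₂) :
    Regular (centeredBlend d₁ d₂ I J P₁) x := by
  have hD := (continuous_norm_center_sub I J).continuousAt (x := x)
  rcases lt_or_ge ‖center x I - center x J‖ d₁ with hlt | hge
  · refine hP.congr ?_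
    filter_upwards [hD.eventually_lt continuousAt_const hlt] with y hy
    exact blend_eq_left h hy.le _ _
  · have hpos := h₁.trans_le hge
    refine ⟨?_, ContDiffAt.congr_of_eventuallyEq ?_ (hP.toReal_centeredBlend hpos)⟩
    · filter_upwards [hP.1] with y hy
      rw [Ne, centeredBlend_eq_top_iff h₁ h]
      exact fun H => hy H.2
    · have hn : ContDiffAt ℝ 2 (fun y => ‖centerDiff I J y‖) x := by
        refine (centerDiff I J).contDiff.contDiffAt.norm ℝ ?_
        rw [centerDiff_apply, ← norm_pos_iff]
        exact hpos
      have hw : ContDiffAt ℝ 2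
          (fun y => smoothStep ((‖centerDiff I J y‖ - d₁) / (d₂ - d₁))) x :=
        contDiff_smoothStep.contDiffAt.comp x ((hn.sub contDiffAt_const).div_const _)
      have hc : ContDiffAt ℝ 2 (fun y => centeredReal ‖centerDiff I J y‖) x := by
        refine ContDiffAt.comp x (g := centeredReal) (contDiffAt_centeredReal ?_) hn
        rwa [centerDiff_apply]
      exact ((contDiffAt_const.sub hw).mul hP.2).add (hw.mul hc)

/-- The derivative of the blend is a mixture of the derivative of `P₁` and of a decreasing function
of the distance of the centers: both the centered potential and, as it is at most `P₁`, the shift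
of the weight push the two sides apart. -/
theorem Regular.exists_fderiv_centeredBlend (hP : Regular P₁ x) (h₁ : 0 < d₁) (h : d₁ < d₂)
    (hD : d₁ ≤ ‖center x I - center x J‖) (hle : centeredPotential I J x ≤ P₁ x) :
    ∃ α β : ℝ, 0 ≤ α ∧ 0 ≤ β ∧ 0 < α + β ∧ ∀ v,
      fderiv ℝ (fun y => (ContactBSH.centeredBlend d₁ d₂ I J P₁ y).toReal) x v =
        α * fderiv ℝ (fun y => (P₁ y).toReal) x v
          - β * inner ℝ (center x I - center x J) (centerDiff I J v) := by
  have hpos := h₁.trans_le hD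
  have ha : centerDiff I J x ≠ 0 := by
    rw [centerDiff_apply, ← norm_pos_iff]
    exact hpos
  set D := ‖centerDiff I J x‖ with hDdef
  have hDpos : 0 < D := norm_pos_iff.2 ha
  set w := smoothStep ((D - d₁) / (d₂ - d₁)) with hw
  obtain ⟨c, hc, hcd⟩ := exists_hasDerivAt_centeredReal hDpos
  have hs : HasDerivAt smoothStep (deriv smoothStep ((D - d₁) / (d₂ - d₁)))
      ((D - d₁) / (d₂ - d₁)) :=
    (contDiff_smoothStep.differentiable (by norm_num) _).hasDerivAt
  set s' := deriv smoothStep ((D - d₁) / (d₂ - d₁))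
  have hs0 : 0 ≤ s' := smoothStep_monotone.deriv_nonneg
  have hn : HasFDerivAt (fun y => ‖centerDiff I J y‖)
      ((D⁻¹ • innerSL ℝ (centerDiff I J x)) ∘L centerDiff I J) x :=
    (hasFDerivAt_norm_of_ne_zero ha).comp x (centerDiff I J).hasFDerivAt
  have hq : HasDerivAt (fun D : ℝ => (D - d₁) / (d₂ - d₁)) (1 / (d₂ - d₁)) D :=
    ((hasDerivAt_id D).sub_const d₁).div_const _
  have hW := (hs.comp D hq).comp_hasFDerivAt x hn
  have hC := hcd.comp_hasFDerivAt x hn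
  have hF := hP.differentiableAt.hasFDerivAt
  have hfull := ((hW.const_sub 1).mul hF).add (hW.mul hC)
  have hle' : centeredReal D ≤ (P₁ x).toReal := by
    have := ENNReal.toReal_mono hP.ne_top hle
    rwa [centeredPotential_eq hpos, ENNReal.toReal_ofReal
      (by unfold centeredReal; positivity), ← centerDiff_apply] at this
  have hd : 0 < d₂ - d₁ := sub_pos.2 h
  have hw0 : 0 ≤ w := smoothStep_nonneg _
  have hw1 : w ≤ 1 := smoothStep_le_one _
  -- the weight contributes `s'`, the centered potential its derivative `c < 0`; the factor `D⁻¹` is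
  -- that of the derivative of the norm
  refine ⟨1 - w, (s' / (d₂ - d₁) * ((P₁ x).toReal - centeredReal D) + w * (-c)) / D,
    sub_nonneg.2 hw1, ?_, ?_, fun v => ?_⟩
  · have := sub_nonneg.2 hle'
    have := neg_pos.2 hc
    positivity
  · have h3 : 0 ≤ s' / (d₂ - d₁) * ((P₁ x).toReal - centeredReal D) :=
      mul_nonneg (div_nonneg hs0 hd.le) (sub_nonneg.2 hle')
    have h4 : 0 ≤ w * (-c) := mul_nonneg hw0 (neg_pos.2 hc).le
    rcases hw1.eq_or_lt with h5 | h5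
    · rw [h5] at h4 ⊢
      have : 0 < (s' / (d₂ - d₁) * ((P₁ x).toReal - centeredReal D) + 1 * (-c)) / D :=
        div_pos (by linarith) hDpos
      linarith
    · have : 0 ≤ (s' / (d₂ - d₁) * ((P₁ x).toReal - centeredReal D) + w * (-c)) / D :=
        div_nonneg (by linarith) hDpos.le
      linarith
  · rw [(hP.toReal_centeredBlend hpos).fderiv_eq]
    refine (DFunLike.congr_fun hfull.fderiv v).trans ?_
    rw [← centerDiff_apply]
    simp only [add_apply, smul_apply, ContinuousLinearMap.comp_apply, innerSL_apply_apply,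
      smul_eq_mul, neg_apply, Function.comp_apply]
    rw [← hDdef, ← hw]
    field_simp
    ring

theorem NonPrehensile.centeredBlend (hN : NonPrehensile P₁ I J x) (hP : Regular P₁ x)
    (h₁ : 0 < d₁) (h : d₁ < d₂) (hD : d₁ ≤ ‖center x I - center x J‖)
    (hle : centeredPotential I J x ≤ P₁ x) (hdisj : Disjoint I J) (hI : I.Nonempty)
    (hJ : J.Nonempty) : NonPrehensile (centeredBlend d₁ d₂ I J P₁) I J x := by
  obtain ⟨α, β, hα, hβ, hαβ, hf⟩ := hP.exists_fderiv_centeredBlend h₁ h hD hle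
  have hR := (hP.centeredBlend (I := I) (J := J) h₁ h).differentiableAt
  have comb : ∀ {K L : Finset (Fin V)} {u v : E3} {γ : ℝ}, 0 < γ → u ∈ forceCone x L K →
      v ∈ forceCone x L K → α • u + (β * γ) • v ∈ forceCone x L K := by
    intro K L u v γ hγ hu hv
    rcases hα.eq_or_lt with rfl | hα'
    · rw [zero_smul, zero_add]
      exact smul_mem_forceCone (mul_pos (by linarith) hγ) hv
    rcases hβ.eq_or_lt with rfl | hβ'
    · rw [zero_mul, zero_smul, add_zero]
      exact smul_mem_forceCone hα' hu
    · exact add_mem_forceCone (smul_mem_forceCone hα' hu)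
        (smul_mem_forceCone (mul_pos hβ' hγ) hv)
  have hc : center x I - center x J ∈ forceCone x J I :=
    ⟨1, one_pos, _, center_mem_hull hI, _, center_mem_hull hJ, (one_smul _ _).symm⟩
  have hIc : (0 : ℝ) < (I.card : ℝ)⁻¹ := by
    have := hI.card_pos
    positivity
  have hJc : (0 : ℝ) < (J.card : ℝ)⁻¹ := by
    have := hJ.card_pos
    positivity
  refine ⟨fun i hi => ?_, fun j hj => ?_⟩
  · rw [contactForce_eq_of_fderiv (w := α • contactForce P₁ x i
      + (β * (I.card : ℝ)⁻¹) • (center x I - center x J)) hR fun v => ?_]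
    · exact comb hIc (hN.1 i hi) hc
    · rw [hf, centerDiff_single_left hdisj hi, inner_add_left, real_inner_smul_left,
        real_inner_smul_left, real_inner_smul_right, inner_contactForce hP.differentiableAt]
      ring
  · rw [contactForce_eq_of_fderiv (w := α • contactForce P₁ x j
      + (β * (J.card : ℝ)⁻¹) • (-(center x I - center x J))) hR fun v => ?_]
    · exact comb hJc (hN.2 j hj) (neg_mem_forceCone hc)
    · rw [hf, centerDiff_single_right hdisj hj, inner_add_left, real_inner_smul_left,
        real_inner_smul_left, inner_neg_right, inner_neg_left, real_inner_smul_right,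
        inner_contactForce hP.differentiableAt]
      ring

theorem dependsOn_centeredBlend {U : Set (Fin V)} (hP : DependsOn P₁ U) (hI : (I : Set (Fin V)) ⊆ U)
    (hJ : (J : Set (Fin V)) ⊆ U) : DependsOn (centeredBlend d₁ d₂ I J P₁) U := by
  intro y z hyz
  have hc : ∀ {K : Finset (Fin V)}, (K : Set (Fin V)) ⊆ U → center y K = center z K :=
    fun hK => by
      rw [center, center, Finset.sum_congr rfl fun i hi => hyz i (hK hi)]
  simp only [centeredBlend, blend, blendWeight, centeredPotential, hc hI, hc hJ, hP hyz]

end Blend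

namespace Scene

variable {V T B : ℕ} (S : Scene V T B) (s t : Fin T) {x : Config V} {p q : E3 × ℝ}

/-! ### Separating planes of two triangles -/

/-- The signed distance (up to the factor `‖n‖`) of a corner of `s` or `t` from the plane
`p = (n, d)`, counted positively on the side where the corner belongs. It is affine in the
configuration and linear in the plane. -/
def slack (x : Config V) (p : E3 × ℝ) : Fin 3 ⊕ Fin 3 → ℝ
  | .inl k => inner ℝ (x (S.corner s k)) p.1 + p.2
  | .inr k => inner ℝ (x (S.corner t k)) (-p.1) - p.2

/-- The plane `p` separates the triangles `s` and `t` strictly, with a normal of length below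
`1`. -/
def Separates (x : Config V) (p : E3 × ℝ) : Prop :=
  ‖p.1‖ < 1 ∧ ∀ k, 0 < S.slack s t x p k

/-- The real value of the plane objective at separating planes. -/
def planeReal (x : Config V) (p : E3 × ℝ) : ℝ :=
  12 * (1 - ‖p.1‖)⁻¹ + ∑ k, (S.slack s t x p k)⁻¹

/-- The derivative of the plane objective at the plane `p` in direction `η`. -/
def planeDeriv (x : Config V) (p η : E3 × ℝ) : ℝ :=
  12 * (inner ℝ p.1 η.1 / ‖p.1‖ / (1 - ‖p.1‖) ^ 2)
    - ∑ k, S.slack s t x η k / S.slack s t x p k ^ 2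

variable {s t}

theorem slack_add_smul_plane (η : E3 × ℝ) (r : ℝ) (k : Fin 3 ⊕ Fin 3) :
    S.slack s t x (p + r • η) k = S.slack s t x p k + r * S.slack s t x η k := by
  cases k <;>
    simp only [slack, Prod.fst_add, Prod.snd_add, Prod.smul_fst, Prod.smul_snd, inner_add_right,
      inner_neg_right, real_inner_smul_right, smul_eq_mul] <;> ring

theorem slack_add_smul_config (w : Config V) (r : ℝ) (k : Fin 3 ⊕ Fin 3) :
    S.slack s t (x + r • w) p k = S.slack s t x p k + r * S.slack s t w (p.1, 0) k := by
  cases k <;>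
    simp only [slack, Pi.add_apply, Pi.smul_apply, inner_add_left, real_inner_smul_left] <;> ring

theorem planeObjective_eq_sum (n : E3) (d : ℝ) :
    S.planeObjective s t n d x = 12 * invPos (1 - ‖n‖) + ∑ k, invPos (S.slack s t x (n, d) k) := by
  rw [Fintype.sum_sum_type, planeObjective, add_assoc]
  rfl

theorem invPos_ne_top_iff {r : ℝ} : invPos r ≠ ∞ ↔ 0 < r := by
  simp [invPos]

theorem invPos_eq_ofReal {r : ℝ} (h : 0 < r) : invPos r = ENNReal.ofReal r⁻¹ :=
  (ENNReal.ofReal_inv_of_pos h).symm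

theorem planeObjective_ne_top_iff :
    S.planeObjective s t p.1 p.2 x ≠ ∞ ↔ S.Separates s t x p := by
  rw [planeObjective_eq_sum, ENNReal.add_ne_top, ENNReal.sum_ne_top]
  simp only [invPos_ne_top_iff, Finset.mem_univ, true_implies, Separates]
  refine and_congr_left fun _ => ?_
  rw [← sub_pos (b := ‖p.1‖), ← invPos_ne_top_iff, not_iff_not, ENNReal.mul_eq_top]
  simp

theorem planeObjective_eq_ofReal (h : S.Separates s t x p) :
    S.planeObjective s t p.1 p.2 x = ENNReal.ofReal (S.planeReal s t x p) := by
  have h1 : 0 < 1 - ‖p.1‖ := sub_pos.2 h.1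
  have h2 : ∀ k, 0 ≤ (S.slack s t x p k)⁻¹ := fun k => (inv_pos.2 (h.2 k)).le
  rw [planeObjective_eq_sum, planeReal, ENNReal.ofReal_add (by positivity)
    (Finset.sum_nonneg fun k _ => h2 k), ENNReal.ofReal_mul (by norm_num),
    ENNReal.ofReal_sum_of_nonneg fun k _ => h2 k, invPos_eq_ofReal h1]
  simp [invPos_eq_ofReal (h.2 _)]

theorem exactPotential_le (p : E3 × ℝ) :
    S.exactPotential s t x ≤ S.planeObjective s t p.1 p.2 x := iInf_le _ p

theorem Separates.normal_ne_zero {S : Scene V T B} (h : S.Separates s t x p) : p.1 ≠ 0 := by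
  intro h0
  have h1 := h.2 (.inl 0)
  have h2 := h.2 (.inr 0)
  simp [slack, h0] at h1 h2
  linarith

theorem planeReal_nonneg (h : S.Separates s t x p) : 0 ≤ S.planeReal s t x p := by
  have h1 : 0 < 1 - ‖p.1‖ := sub_pos.2 h.1
  exact add_nonneg (by positivity) (Finset.sum_nonneg fun k _ => (inv_pos.2 (h.2 k)).le)

theorem continuous_slack (k : Fin 3 ⊕ Fin 3) :
    Continuous fun z : Config V × (E3 × ℝ) => S.slack s t z.1 z.2 k := by
  cases k <;> simp only [slack] <;> fun_prop

theorem isOpen_separates :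
    IsOpen {z : Config V × (E3 × ℝ) | S.Separates s t z.1 z.2} := by
  have : {z : Config V × (E3 × ℝ) | S.Separates s t z.1 z.2} =
      {z | ‖z.2.1‖ < 1} ∩ ⋂ k, {z | 0 < S.slack s t z.1 z.2 k} := by
    ext z
    simp [Separates]
  rw [this]
  exact (isOpen_lt (by fun_prop) continuous_const).inter
    (isOpen_iInter_of_finite fun k => isOpen_lt continuous_const (S.continuous_slack k))

theorem continuous_invPos : Continuous invPos := continuous_inv.comp ENNReal.continuous_ofReal

theorem continuous_planeObjective :
    Continuous fun z : Config V × (E3 × ℝ) => S.planeObjective s t z.2.1 z.2.2 z.1 := by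
  simp only [planeObjective_eq_sum]
  refine ((ENNReal.continuous_const_mul (by norm_num)).comp (continuous_invPos.comp
    (by fun_prop))).add (continuous_finsetSum _ fun k _ => continuous_invPos.comp ?_)
  exact S.continuous_slack k

theorem Separates.abs_offset_le {S : Scene V T B} (h : S.Separates s t x p) : |p.2| ≤ ‖x‖ := by
  have h1 := h.2 (.inl 0)
  have h2 := h.2 (.inr 0)
  have hb : ∀ i, |inner ℝ (x i) p.1| ≤ ‖x‖ := fun i =>
    (abs_real_inner_le_norm _ _).trans ((mul_le_mul (norm_le_pi_norm x i) h.1.le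
      (norm_nonneg _) (norm_nonneg _)).trans (by rw [mul_one]))
  have b1 := abs_le.1 (hb (S.corner s 0))
  have b2 := abs_le.1 (hb (S.corner t 0))
  simp only [slack, inner_neg_right] at h1 h2
  exact abs_le.2 ⟨by linarith, by linarith⟩

/-- A compact set of planes which contains all planes separating two triangles in configurations of
norm at most `M`. -/
def planes (M : ℝ) : Set (E3 × ℝ) := Metric.closedBall 0 1 ×ˢ Set.Icc (-M) M

theorem isCompact_planes (M : ℝ) : IsCompact (planes M) :=
  (isCompact_closedBall _ _).prod isCompact_Icc

theorem Separates.mem_planes {S : Scene V T B} (h : S.Separates s t x p) {M : ℝ} (hM : ‖x‖ ≤ M) :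
    p ∈ planes M :=
  ⟨by simpa using h.1.le, abs_le.1 (h.abs_offset_le.trans hM)⟩

theorem exactPotential_eq_sInf {M : ℝ} (hM : ‖x‖ ≤ M) :
    S.exactPotential s t x =
      sInf ((fun p : E3 × ℝ => S.planeObjective s t p.1 p.2 x) '' planes M) := by
  rw [sInf_image]
  refine le_antisymm (le_iInf₂ fun p _ => S.exactPotential_le p) (le_iInf fun p => ?_)
  by_cases h : S.planeObjective s t p.1 p.2 x = ∞
  · simp [h]
  · exact iInf₂_le p ((S.planeObjective_ne_top_iff.1 h).mem_planes hM)

/-- Near each configuration only a compact set of planes matters, so the infimum is continuous. -/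
theorem continuous_exactPotential : Continuous (S.exactPotential s t) := by
  refine continuous_iff_continuousAt.2 fun x => ?_
  have hc : Continuous fun y => sInf
      ((fun p : E3 × ℝ => S.planeObjective s t p.1 p.2 y) '' planes (‖x‖ + 1)) :=
    (isCompact_planes (‖x‖ + 1)).continuous_sInf
      (f := fun (y : Config V) (p : E3 × ℝ) => S.planeObjective s t p.1 p.2 y)
      S.continuous_planeObjective
  refine hc.continuousAt.congr ?_
  filter_upwards [continuous_norm.continuousAt.eventually_lt continuousAt_const
    (lt_add_one ‖x‖)] with y hy
  exact (S.exactPotential_eq_sInf hy.le).symm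

theorem exists_separates_of_exactPotential_ne_top (h : S.exactPotential s t x ≠ ∞) :
    ∃ p, S.Separates s t x p ∧ S.exactPotential s t x = ENNReal.ofReal (S.planeReal s t x p) := by
  have hne : (planes ‖x‖).Nonempty := ⟨0, by simp [planes]⟩
  obtain ⟨p, -, hp⟩ := (isCompact_planes ‖x‖).exists_isMinOn hne
    (S.continuous_planeObjective.comp (Continuous.prodMk_right x)).continuousOn
  have he : S.exactPotential s t x = S.planeObjective s t p.1 p.2 x := by
    refine le_antisymm (S.exactPotential_le p) ?_
    rw [S.exactPotential_eq_sInf le_rfl]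
    exact le_sInf (by rintro _ ⟨q, hq, rfl⟩; exact hp hq)
  rw [he] at h
  have hs := S.planeObjective_ne_top_iff.1 h
  exact ⟨p, hs, he.trans (S.planeObjective_eq_ofReal hs)⟩

theorem corner_mem_triVerts (t : Fin T) (k : Fin 3) : S.corner t k ∈ S.triVerts t :=
  Finset.mem_image_of_mem _ (Finset.mem_univ k)

theorem mem_triVerts {i : Fin V} : i ∈ S.triVerts t ↔ ∃ k, S.corner t k = i := by
  simp [triVerts]

theorem Separates.disjoint_hull {S : Scene V T B} (h : S.Separates s t x p) :
    Disjoint (hull x (S.triVerts s)) (hull x (S.triVerts t)) := by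
  have h1 : hull x (S.triVerts s) ⊆ {y | -p.2 < innerSL ℝ p.1 y} := by
    refine convexHull_min ?_ (convex_halfSpace_gt (innerSL ℝ p.1).isLinear _)
    rintro _ ⟨i, hi, rfl⟩
    obtain ⟨k, rfl⟩ := S.mem_triVerts.1 hi
    have := h.2 (.inl k)
    rw [slack, real_inner_comm] at this
    simp only [Set.mem_ofPred_eq, innerSL_apply_apply]
    linarith
  have h2 : hull x (S.triVerts t) ⊆ {y | innerSL ℝ p.1 y < -p.2} := by
    refine convexHull_min ?_ (convex_halfSpace_lt (innerSL ℝ p.1).isLinear _)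
    rintro _ ⟨i, hi, rfl⟩
    obtain ⟨k, rfl⟩ := S.mem_triVerts.1 hi
    have := h.2 (.inr k)
    rw [slack, inner_neg_right, real_inner_comm] at this
    simp only [Set.mem_ofPred_eq, innerSL_apply_apply]
    linarith
  exact Set.disjoint_left.2 fun y hs ht => by
    have a := h1 hs
    have b := h2 ht
    simp only [Set.mem_ofPred_eq] at a b
    exact lt_asymm a b

theorem exists_separates (h : Disjoint (hull x (S.triVerts s)) (hull x (S.triVerts t))) :
    ∃ p, S.Separates s t x p := by
  obtain ⟨f, u, v, hu, huv, hv⟩ := geometric_hahn_banach_compact_closed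
    (convex_convexHull ℝ _) (isCompact_hull x (S.triVerts t)) (convex_convexHull ℝ _)
    (isCompact_hull x (S.triVerts s)).isClosed h.symm
  set n := (InnerProductSpace.toDual ℝ E3).symm f with hn
  have hf : ∀ y, f y = inner ℝ y n := fun y => by
    rw [real_inner_comm, hn, InnerProductSpace.toDual_symm_apply]
  -- the functional is scaled to norm below one
  have hc : 0 < (‖n‖ + 1)⁻¹ := by positivity
  refine ⟨((‖n‖ + 1)⁻¹ • n, -((‖n‖ + 1)⁻¹ * ((u + v) / 2))), ?_, ?_⟩
  · rw [norm_smul, Real.norm_of_nonneg hc.le, inv_mul_lt_iff₀ (by positivity)]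
    linarith
  · have hs : ∀ k, v < inner ℝ (x (S.corner s k)) n := fun k => by
      rw [← hf]
      exact hv _ (subset_convexHull ℝ _ ⟨_, S.corner_mem_triVerts s k, rfl⟩)
    have ht : ∀ k, inner ℝ (x (S.corner t k)) n < u := fun k => by
      rw [← hf]
      exact hu _ (subset_convexHull ℝ _ ⟨_, S.corner_mem_triVerts t k, rfl⟩)
    rintro (k | k)
    · have := mul_pos hc (show 0 < inner ℝ (x (S.corner s k)) n - (u + v) / 2 by
        linarith [hs k])
      simp only [slack, real_inner_smul_right]
      linarith
    · have := mul_pos hc (show 0 < (u + v) / 2 - inner ℝ (x (S.corner t k)) n by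
        linarith [ht k])
      simp only [slack, real_inner_smul_right, inner_neg_right]
      linarith

theorem exactPotential_eq_top_iff : S.exactPotential s t x = ∞ ↔
    (hull x (S.triVerts s) ∩ hull x (S.triVerts t)).Nonempty := by
  rw [← Set.not_disjoint_iff_nonempty_inter, ← not_iff_not, not_not]
  constructor
  · intro h
    obtain ⟨p, hp, -⟩ := S.exists_separates_of_exactPotential_ne_top h
    exact hp.disjoint_hull
  · intro h
    obtain ⟨p, hp⟩ := S.exists_separates h
    exact ne_top_of_le_ne_top (S.planeObjective_ne_top_iff.2 hp) (S.exactPotential_le p)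

theorem sum_triVerts {M : Type*} [AddCommMonoid M] (t : Fin T) (f : Fin V → M) :
    ∑ i ∈ S.triVerts t, f i = ∑ k, f (S.corner t k) :=
  Finset.sum_image fun _ _ _ _ h => S.corner_injective t h

theorem card_triVerts (t : Fin T) : (S.triVerts t).card = 3 := by
  rw [triVerts, Finset.card_image_of_injective _ (S.corner_injective t)]
  simp

/-- By the Cauchy–Schwarz inequality in Sedrakyan's form, used for the slacks and for the
length of the normal, no plane does better than the centered potential. -/
theorem Separates.centered_le {S : Scene V T B} (h : S.Separates s t x p) :
    0 < ‖center x (S.triVerts s) - center x (S.triVerts t)‖ ∧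
      centeredReal ‖center x (S.triVerts s) - center x (S.triVerts t)‖ ≤ S.planeReal s t x p := by
  set D := ‖center x (S.triVerts s) - center x (S.triVerts t)‖
  set r := ‖p.1‖
  have hr1 : 0 < 1 - r := sub_pos.2 h.1
  have hr0 : 0 < r := norm_pos_iff.2 h.normal_ne_zero
  have hsum : ∑ k, S.slack s t x p k =
      3 * inner ℝ (center x (S.triVerts s) - center x (S.triVerts t)) p.1 := by
    rw [center, center, card_triVerts, card_triVerts, sum_triVerts, sum_triVerts,
      Fintype.sum_sum_type]
    simp only [slack, Fin.sum_univ_three, inner_sub_left, real_inner_smul_left, inner_add_left,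
      inner_neg_right]
    push_cast
    ring
  have hpos : 0 < ∑ k, S.slack s t x p k :=
    Finset.sum_pos (fun k _ => h.2 k) ⟨.inl 0, Finset.mem_univ _⟩
  have hle : ∑ k, S.slack s t x p k ≤ 3 * (D * r) := by
    rw [hsum]
    gcongr
    exact real_inner_le_norm _ _
  have hDr : 0 < D * r := by linarith
  have hD : 0 < D := pos_of_mul_pos_left hDr hr0.le
  refine ⟨hD, ?_⟩
  -- there are six slacks, and `36 = (1 + ⋯ + 1)²`
  have h1 : (36 : ℝ) / ∑ k, S.slack s t x p k ≤ ∑ k, (S.slack s t x p k)⁻¹ := by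
    have := Finset.sq_sum_div_le_sum_sq_div Finset.univ (fun _ : Fin 3 ⊕ Fin 3 => (1 : ℝ))
      (g := S.slack s t x p) fun k _ => h.2 k
    simp only [one_pow, one_div] at this
    refine le_trans (le_of_eq ?_) this
    norm_num
  have h2 : 36 / (3 * (D * r)) ≤ (36 : ℝ) / ∑ k, S.slack s t x p k := by gcongr
  have hs : 0 < √D := Real.sqrt_pos.2 hD
  have h3 : centeredReal D ≤ 12 * (1 - r)⁻¹ + 36 / (3 * (D * r)) := by
    have e : 12 * (1 - r)⁻¹ + 36 / (3 * (D * r)) - centeredReal D =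
        12 * (r - (√D)⁻¹ * (1 - r)) ^ 2 / (r * (1 - r)) := by
      have hD2 : D = √D ^ 2 := (Real.sq_sqrt hD.le).symm
      unfold centeredReal
      rw [show 36 / (3 * (D * r)) = 12 * (√D)⁻¹ ^ 2 / r by
        rw [inv_pow, ← hD2]
        field_simp
        norm_num]
      field_simp
      ring
    have : 0 ≤ 12 * (r - (√D)⁻¹ * (1 - r)) ^ 2 / (r * (1 - r)) := by positivity
    linarith
  exact h3.trans (add_le_add_right (h2.trans h1) _)

theorem centeredPotential_le_exactPotential :
    centeredPotential (S.triVerts s) (S.triVerts t) x ≤ S.exactPotential s t x := by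
  by_cases h : S.exactPotential s t x = ∞
  · simp [h]
  · obtain ⟨p, hp, he⟩ := S.exists_separates_of_exactPotential_ne_top h
    obtain ⟨h1, h2⟩ := hp.centered_le
    rw [he, centeredPotential_eq h1]
    exact ENNReal.ofReal_le_ofReal h2

end Scene

namespace Scene

variable {V T B : ℕ} (S : Scene V T B) {s t : Fin T} {x : Config V} {p q η : E3 × ℝ}

/-! ### Derivatives and convexity of the plane objective -/

theorem Separates.eventually {S : Scene V T B} (h : S.Separates s t x p) {X : Type*}
    [TopologicalSpace X] {f : X → Config V × (E3 × ℝ)} {a : X} (hf : ContinuousAt f a)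
    (ha : f a = (x, p)) : ∀ᶠ b in 𝓝 a, S.Separates s t (f b).1 (f b).2 :=
  hf.eventually (S.isOpen_separates.mem_nhds (by rw [ha]; exact h))

theorem hasDerivAt_slack_plane (r : ℝ) (k : Fin 3 ⊕ Fin 3) :
    HasDerivAt (fun r : ℝ => S.slack s t x (p + r • η) k) (S.slack s t x η k) r := by
  simp only [slack_add_smul_plane]
  simpa using ((hasDerivAt_id r).mul_const (S.slack s t x η k)).const_add (S.slack s t x p k)

theorem Separates.hasDerivAt_planeReal {S : Scene V T B} {r : ℝ}
    (h : S.Separates s t x (p + r • η)) :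
    HasDerivAt (fun r : ℝ => S.planeReal s t x (p + r • η))
      (S.planeDeriv s t x (p + r • η) η) r := by
  have h1 : 1 - ‖(p + r • η).1‖ ≠ 0 := (sub_pos.2 h.1).ne'
  have hn := (((hasDerivAt_norm_line (n := p.1) (v := η.1) (r := r) h.normal_ne_zero).const_sub
    1).fun_inv h1).const_mul 12
  have hs := HasDerivAt.fun_sum fun k (_ : k ∈ Finset.univ) =>
    (S.hasDerivAt_slack_plane (s := s) (t := t) (x := x) (p := p) (η := η) r k).fun_inv (h.2 k).ne'
  refine (hn.add hs).congr_deriv ?_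
  simp only [neg_div, Finset.sum_neg_distrib, neg_neg]
  rw [← sub_eq_add_neg]
  rfl

/-- The plane objective has positive second derivatives at separating planes: the barrier of the
normal is strictly convex away from zero, and the slacks depend on the offset. -/
theorem Separates.exists_hasDerivAt_planeDeriv {S : Scene V T B} (h : S.Separates s t x p)
    (hη : η ≠ 0) :
    ∃ c, 0 < c ∧ HasDerivAt (fun r : ℝ => S.planeDeriv s t x (p + r • η) η) c 0 := by
  obtain ⟨n, d⟩ := p
  obtain ⟨v, e⟩ := η
  have hn0 : n ≠ 0 := h.normal_ne_zero
  have hn : 0 < ‖n‖ := norm_pos_iff.2 hn0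
  have h1 : 0 < 1 - ‖n‖ := sub_pos.2 h.1
  have hnorm : HasDerivAt (fun r : ℝ => ‖n + r • v‖) (inner ℝ n v / ‖n‖) 0 := by
    simpa using hasDerivAt_norm_line (n := n) (v := v) (r := 0) (by simpa using hn0)
  have hin : HasDerivAt (fun r : ℝ => (inner ℝ (n + r • v) v : ℝ)) (‖v‖ ^ 2) 0 := by
    simp only [inner_add_left, real_inner_smul_left, real_inner_self_eq_norm_sq]
    simpa using ((hasDerivAt_id (0 : ℝ)).mul_const (‖v‖ ^ 2)).const_add (inner ℝ n v)
  have hA := ((hin.fun_div hnorm (by simpa using hn.ne')).fun_div ((hnorm.const_sub 1).fun_pow 2)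
    (by simpa using h1.ne')).const_mul 12
  have hB := HasDerivAt.fun_sum fun k (_ : k ∈ Finset.univ) =>
    (hasDerivAt_const (0 : ℝ) (S.slack s t x (v, e) k)).fun_div
      ((S.hasDerivAt_slack_plane (s := s) (t := t) (x := x) (p := (n, d)) (η := (v, e))
        0 k).fun_pow 2)
      (by simpa using (h.2 k).ne')
  refine ⟨_, ?_, hA.sub hB⟩
  -- the three nonnegative parts of the second derivative: two from the barrier of the normal, the
  -- first of them by the Cauchy–Schwarz inequality, and one from the slacks
  have hcs : 0 ≤ ‖v‖ ^ 2 * ‖n‖ ^ 2 - inner ℝ n v ^ 2 := by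
    have := abs_real_inner_le_norm n v
    have := pow_le_pow_left₀ (abs_nonneg _) this 2
    rw [sq_abs] at this
    linarith [mul_pow ‖n‖ ‖v‖ 2]
  have hBt : ∀ k, 0 ≤ 2 * S.slack s t x (v, e) k ^ 2 / S.slack s t x (n, d) k ^ 3 := fun k => by
    have := h.2 k
    positivity
  have eB : ∀ k, (0 * S.slack s t x ((n, d) + (0 : ℝ) • (v, e)) k ^ 2
      - S.slack s t x (v, e) k *
        (((2 : ℕ) : ℝ) * S.slack s t x ((n, d) + (0 : ℝ) • (v, e)) k ^ (2 - 1)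
          * S.slack s t x (v, e) k)) / (S.slack s t x ((n, d) + (0 : ℝ) • (v, e)) k ^ 2) ^ 2 =
      - (2 * S.slack s t x (v, e) k ^ 2 / S.slack s t x (n, d) k ^ 3) := fun k => by
    have := (h.2 k).ne'
    rw [zero_smul, add_zero]
    push_cast
    field_simp
    ring
  rw [Finset.sum_congr rfl fun k _ => eB k, Finset.sum_neg_distrib, sub_neg_eq_add]
  rw [zero_smul, add_zero]
  have eA : 12 * ((((‖v‖ ^ 2 * ‖n‖ - inner ℝ n v * (inner ℝ n v / ‖n‖)) / ‖n‖ ^ 2) * (1 - ‖n‖) ^ 2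
      - inner ℝ n v / ‖n‖ * (((2 : ℕ) : ℝ) * (1 - ‖n‖) ^ (2 - 1) * (-(inner ℝ n v / ‖n‖))))
        / ((1 - ‖n‖) ^ 2) ^ 2) =
      12 * ((‖v‖ ^ 2 * ‖n‖ ^ 2 - inner ℝ n v ^ 2) / (‖n‖ ^ 3 * (1 - ‖n‖) ^ 2))
        + 24 * (inner ℝ n v ^ 2 / (‖n‖ ^ 2 * (1 - ‖n‖) ^ 3)) := by
    push_cast
    field_simp
    ring
  rw [eA]
  have hP1 : 0 ≤ 12 * ((‖v‖ ^ 2 * ‖n‖ ^ 2 - inner ℝ n v ^ 2) / (‖n‖ ^ 3 * (1 - ‖n‖) ^ 2)) := by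
    positivity
  have hP2 : 0 ≤ 24 * (inner ℝ n v ^ 2 / (‖n‖ ^ 2 * (1 - ‖n‖) ^ 3)) := by positivity
  have hP3 := Finset.sum_nonneg fun k (_ : k ∈ Finset.univ) => hBt k
  by_cases hv : v = 0
  · have he : e ≠ 0 := by
      rintro rfl
      exact hη (by rw [hv]; rfl)
    have hk : 0 < 2 * S.slack s t x (v, e) (.inl 0) ^ 2 / S.slack s t x (n, d) (.inl 0) ^ 3 := by
      have h2 := h.2 (.inl 0)
      have h3 : S.slack s t x (v, e) (.inl 0) = e := by simp [slack, hv]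
      rw [h3]
      positivity
    have := hk.trans_le (Finset.single_le_sum (fun k _ => hBt k) (Finset.mem_univ (Sum.inl 0)))
    linarith
  · by_cases hi : inner ℝ n v = 0
    · have : 0 < 12 * ((‖v‖ ^ 2 * ‖n‖ ^ 2 - inner ℝ n v ^ 2) / (‖n‖ ^ 3 * (1 - ‖n‖) ^ 2)) := by
        have : 0 < ‖v‖ := norm_pos_iff.2 hv
        rw [hi, zero_pow two_ne_zero, sub_zero]
        positivity
      linarith
    · have : 0 < 24 * (inner ℝ n v ^ 2 / (‖n‖ ^ 2 * (1 - ‖n‖) ^ 3)) := by positivity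
      linarith

/-- The plane objective is convex on separating planes, so it lies above its tangents. -/
theorem Separates.planeReal_add_planeDeriv_le {S : Scene V T B} (hp : S.Separates s t x p)
    (hq : S.Separates s t x q) :
    S.planeReal s t x p + S.planeDeriv s t x p (q - p) ≤ S.planeReal s t x q := by
  have h1 : 0 < 1 - ‖p.1‖ := sub_pos.2 hp.1
  have h2 : 0 < 1 - ‖q.1‖ := sub_pos.2 hq.1
  have hn : 0 < ‖p.1‖ := norm_pos_iff.2 hp.normal_ne_zero
  have hs : ∀ k, S.slack s t x (q - p) k = S.slack s t x q k - S.slack s t x p k := fun k => by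
    have := S.slack_add_smul_plane (s := s) (t := t) (x := x) (p := p) (q - p) 1 k
    rw [one_smul, add_sub_cancel, one_mul] at this
    linarith
  have hin : inner ℝ p.1 (q - p).1 / ‖p.1‖ ≤ ‖q.1‖ - ‖p.1‖ := by
    rw [div_le_iff₀ hn, Prod.fst_sub, inner_sub_right, real_inner_self_eq_norm_sq]
    linarith [real_inner_le_norm p.1 q.1, mul_comm ‖q.1‖ ‖p.1‖]
  have hnorm : (1 - ‖p.1‖)⁻¹ + inner ℝ p.1 (q - p).1 / ‖p.1‖ / (1 - ‖p.1‖) ^ 2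
      ≤ (1 - ‖q.1‖)⁻¹ := by
    have a := inv_add_deriv_le_inv h1 h2
    have b := div_le_div_of_nonneg_right hin (sq_nonneg (1 - ‖p.1‖))
    have c : (1 - ‖q.1‖ - (1 - ‖p.1‖)) / (1 - ‖p.1‖) ^ 2
        = -((‖q.1‖ - ‖p.1‖) / (1 - ‖p.1‖) ^ 2) := by ring
    linarith
  have hsum : ∑ k, (S.slack s t x p k)⁻¹ - ∑ k, S.slack s t x (q - p) k / S.slack s t x p k ^ 2
      ≤ ∑ k, (S.slack s t x q k)⁻¹ := by
    rw [← Finset.sum_sub_distrib]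
    refine Finset.sum_le_sum fun k _ => ?_
    rw [hs]
    exact inv_add_deriv_le_inv (hp.2 k) (hq.2 k)
  unfold planeReal planeDeriv
  linarith

theorem Separates.contDiffAt_planeReal {S : Scene V T B} (h : S.Separates s t x p) :
    ContDiffAt ℝ 3 (fun z : Config V × (E3 × ℝ) => S.planeReal s t z.1 z.2) (x, p) := by
  have hn : ContDiffAt ℝ 3 (fun z : Config V × (E3 × ℝ) => ‖z.2.1‖) (x, p) :=
    ContDiffAt.norm ℝ (by fun_prop) h.normal_ne_zero
  have hs : ∀ k, ContDiffAt ℝ 3 (fun z : Config V × (E3 × ℝ) => S.slack s t z.1 z.2 k) (x, p) := by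
    rintro (k | k)
    · exact ContDiffAt.add (ContDiffAt.inner ℝ (by fun_prop) (by fun_prop)) (by fun_prop)
    · exact ContDiffAt.sub (ContDiffAt.inner ℝ (by fun_prop) (by fun_prop)) (by fun_prop)
  exact (contDiffAt_const.mul ((contDiffAt_const.sub hn).inv (sub_pos.2 h.1).ne')).add
    (ContDiffAt.sum fun k _ => (hs k).inv (h.2 k).ne')

theorem Separates.fderiv_planeReal {S : Scene V T B} (h : S.Separates s t x p) (η : E3 × ℝ) :
    fderiv ℝ (fun z : Config V × (E3 × ℝ) => S.planeReal s t z.1 z.2) (x, p) (0, η) =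
      S.planeDeriv s t x p η := by
  have hd := (h.contDiffAt_planeReal.differentiableAt (by norm_num)).hasFDerivAt
  have hl : HasDerivAt (fun r : ℝ => ((x, p + r • η) : Config V × (E3 × ℝ))) (0, η) 0 := by
    refine (hasDerivAt_const _ _).prodMk ?_
    simpa using ((hasDerivAt_id (0 : ℝ)).smul_const η).const_add p
  have h1 := HasFDerivAt.comp_hasDerivAt (x := (0 : ℝ))
    (f := fun r : ℝ => ((x, p + r • η) : Config V × (E3 × ℝ))) (hl := by simpa using hd) (hf := hl)
  have h2 := Separates.hasDerivAt_planeReal (S := S) (s := s) (t := t) (x := x) (p := p) (η := η)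
    (r := 0) (by simpa using h)
  simpa using h1.unique h2

/-! ### The exact potential of disjoint triangles -/

/-- Around an optimal plane there is a `C²` family of optimal planes, because stationary planes are
optimal by convexity. -/
theorem Separates.exists_contDiffAt_optimal {S : Scene V T B} (h : S.Separates s t x p)
    (h0 : ∀ η, S.planeDeriv s t x p η = 0) :
    ∃ P : Config V → E3 × ℝ, ContDiffAt ℝ 2 P x ∧ P x = p ∧ ∀ᶠ y in 𝓝 x, S.Separates s t y (P y) ∧
      S.exactPotential s t y = ENNReal.ofReal (S.planeReal s t y (P y)) := by
  obtain ⟨P, hP, hPx, hst⟩ := exists_contDiffAt_stationary (z := (x, p)) h.contDiffAt_planeReal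
    (fun η => (h.fderiv_planeReal η).trans (h0 η)) fun η hη => by
      obtain ⟨c, hc, hd⟩ := h.exists_hasDerivAt_planeDeriv hη
      refine ⟨c, hc, hd.congr_of_eventuallyEq ?_⟩
      have := h.eventually (f := fun r : ℝ => (x, p + r • η)) (a := 0)
        (Continuous.continuousAt (by fun_prop)) (by simp)
      filter_upwards [this] with r hr
      simpa using hr.fderiv_planeReal η
  refine ⟨P, hP, hPx, ?_⟩
  filter_upwards [hst, h.eventually (f := fun y => (y, P y)) (a := x)
    (continuousAt_id.prodMk hP.continuousAt) (by rw [hPx])] with y hy hsep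
  refine ⟨hsep, le_antisymm ?_ (le_iInf fun q => ?_)⟩
  · rw [← S.planeObjective_eq_ofReal hsep]
    exact S.exactPotential_le (P y)
  · by_cases hq : S.planeObjective s t q.1 q.2 y = ∞
    · simp [hq]
    · have hq := S.planeObjective_ne_top_iff.1 hq
      rw [S.planeObjective_eq_ofReal hq]
      have h1 := hsep.planeReal_add_planeDeriv_le hq
      rw [← hsep.fderiv_planeReal, hy, add_zero] at h1
      exact ENNReal.ofReal_le_ofReal h1

theorem exists_optimal (h : S.exactPotential s t x ≠ ∞) : ∃ p, S.Separates s t x p ∧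
    S.exactPotential s t x = ENNReal.ofReal (S.planeReal s t x p) ∧
      ∀ η, S.planeDeriv s t x p η = 0 := by
  obtain ⟨p, hp, he⟩ := S.exists_separates_of_exactPotential_ne_top h
  refine ⟨p, hp, he, fun η => ?_⟩
  have hd := Separates.hasDerivAt_planeReal (S := S) (s := s) (t := t) (x := x) (p := p) (η := η)
    (r := 0) (by simpa using hp)
  rw [zero_smul, add_zero] at hd
  refine IsLocalMin.hasDerivAt_eq_zero ?_ hd
  have := hp.eventually (f := fun r : ℝ => (x, p + r • η)) (a := 0)
    (Continuous.continuousAt (by fun_prop)) (by simp)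
  filter_upwards [this] with r hr
  have h1 := S.exactPotential_le (s := s) (t := t) (x := x) (p + r • η)
  rw [S.planeObjective_eq_ofReal hr, he,
    ENNReal.ofReal_le_ofReal_iff (S.planeReal_nonneg hr)] at h1
  simpa using h1

theorem regular_exactPotential (h : S.exactPotential s t x ≠ ∞) :
    Regular (S.exactPotential s t) x := by
  obtain ⟨p, hp, -, h0⟩ := S.exists_optimal h
  obtain ⟨P, hP, rfl, hev⟩ := hp.exists_contDiffAt_optimal h0
  refine ⟨?_, ?_⟩
  · filter_upwards [hev] with y hy
    rw [hy.2]
    exact ENNReal.ofReal_ne_top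
  · have hg : ContDiffAt ℝ 2 (fun z : Config V × (E3 × ℝ) => S.planeReal s t z.1 z.2) (x, P x) :=
      hp.contDiffAt_planeReal.of_le (by norm_num)
    have hf : ContDiffAt ℝ 2 (fun y : Config V => (y, P y)) x := contDiffAt_fun_id.prodMk hP
    have h1 : ContDiffAt ℝ 2 (fun y => S.planeReal s t y (P y)) x :=
      ContDiffAt.comp x (f := fun y => (y, P y)) hg hf
    refine h1.congr_of_eventuallyEq ?_
    filter_upwards [hev] with y hy
    rw [hy.2, ENNReal.toReal_ofReal (S.planeReal_nonneg hy.1)]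

/-- The envelope theorem: the derivative of the exact potential is that of the objective of a fixed
optimal plane. -/
theorem fderiv_exactPotential (hp : S.Separates s t x p)
    (he : S.exactPotential s t x = ENNReal.ofReal (S.planeReal s t x p)) (w : Config V) :
    fderiv ℝ (fun y => (S.exactPotential s t y).toReal) x w =
      -∑ k, S.slack s t w (p.1, 0) k / S.slack s t x p k ^ 2 := by
  have hr := (S.regular_exactPotential (s := s) (t := t) (x := x)
    (by rw [he]; exact ENNReal.ofReal_ne_top)).differentiableAt.hasFDerivAt
  have hl : HasDerivAt (fun r : ℝ => x + r • w) w 0 := by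
    simpa using ((hasDerivAt_id (0 : ℝ)).smul_const w).const_add x
  have h1 := HasFDerivAt.comp_hasDerivAt (x := (0 : ℝ)) (f := fun r : ℝ => x + r • w)
    (hl := by simpa using hr) (hf := hl)
  have h2 : HasDerivAt (fun r : ℝ => S.planeReal s t (x + r • w) p)
      (-∑ k, S.slack s t w (p.1, 0) k / S.slack s t x p k ^ 2) 0 := by
    have hs : ∀ k, HasDerivAt (fun r : ℝ => S.slack s t (x + r • w) p k)
        (S.slack s t w (p.1, 0) k) 0 := fun k => by
      simp only [slack_add_smul_config]
      simpa using ((hasDerivAt_id (0 : ℝ)).mul_const (S.slack s t w (p.1, 0) k)).const_add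
        (S.slack s t x p k)
    have := (HasDerivAt.fun_sum fun k (_ : k ∈ Finset.univ) => (hs k).fun_inv
      (by simpa using (hp.2 k).ne')).const_add (12 * (1 - ‖p.1‖)⁻¹)
    refine this.congr_deriv ?_
    simp [neg_div]
  have h3 := h2.sub h1
  refine (sub_eq_zero.1 (IsLocalMin.hasDerivAt_eq_zero ?_ h3)).symm
  have := hp.eventually (f := fun r : ℝ => (x + r • w, p)) (a := 0)
    (Continuous.continuousAt (by fun_prop)) (by simp)
  filter_upwards [this] with r hr
  have h4 := S.exactPotential_le (s := s) (t := t) (x := x + r • w) p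
  rw [S.planeObjective_eq_ofReal hr] at h4
  have h5 := ENNReal.toReal_mono ENNReal.ofReal_ne_top h4
  rw [ENNReal.toReal_ofReal (S.planeReal_nonneg hr)] at h5
  simpa [he, ENNReal.toReal_ofReal (S.planeReal_nonneg hp)] using h5

/-- The normal of an optimal plane joins a point of one triangle to a point of the other: the
stationarity conditions balance the corners, weighted by inverse squared slacks. -/
theorem Separates.normal_mem_forceCone {S : Scene V T B} (hp : S.Separates s t x p)
    (h0 : ∀ η, S.planeDeriv s t x p η = 0) :
    p.1 ∈ forceCone x (S.triVerts t) (S.triVerts s) := by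
  set a : Fin 3 → ℝ := fun k => (S.slack s t x p (.inl k) ^ 2)⁻¹ with ha
  set b : Fin 3 → ℝ := fun k => (S.slack s t x p (.inr k) ^ 2)⁻¹ with hb
  have ha0 : ∀ k, 0 < a k := fun k => inv_pos.2 (pow_pos (hp.2 _) 2)
  have hb0 : ∀ k, 0 < b k := fun k => inv_pos.2 (pow_pos (hp.2 _) 2)
  have h1 : 0 < 1 - ‖p.1‖ := sub_pos.2 hp.1
  have hn : 0 < ‖p.1‖ := norm_pos_iff.2 hp.normal_ne_zero
  set W := ∑ k, a k with hW
  have hWpos : 0 < W := Finset.sum_pos (fun k _ => ha0 k) ⟨0, Finset.mem_univ _⟩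
  have hWb : ∑ k, b k = W := by
    have := h0 (0, 1)
    rw [planeDeriv, Fintype.sum_sum_type] at this
    simp only [slack, inner_zero_right, neg_zero, zero_add, zero_sub, zero_div, mul_zero, neg_div,
      one_div, Finset.sum_neg_distrib] at this
    simp only [hW, ha, hb, slack]
    linarith
  -- `c • n` is the gradient of the barrier of the normal
  set c := 12 / (‖p.1‖ * (1 - ‖p.1‖) ^ 2) with hc
  have hc0 : 0 < c := by positivity
  have hkey : c • p.1 = ∑ k, a k • x (S.corner s k) - ∑ k, b k • x (S.corner t k) := by
    refine ext_inner_right ℝ fun v => ?_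
    have := h0 (v, 0)
    rw [planeDeriv, Fintype.sum_sum_type] at this
    simp only [slack, inner_neg_right, add_zero, sub_zero, neg_div, Finset.sum_neg_distrib] at this
    rw [inner_sub_left, sum_inner, sum_inner, real_inner_smul_left]
    simp only [real_inner_smul_left]
    have e1 : ∑ k, a k * inner ℝ (x (S.corner s k)) v =
        ∑ k, inner ℝ (x (S.corner s k)) v / (inner ℝ (x (S.corner s k)) p.1 + p.2) ^ 2 :=
      Finset.sum_congr rfl fun k _ => (div_eq_inv_mul _ _).symm
    have e2 : ∑ k, b k * inner ℝ (x (S.corner t k)) v =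
        ∑ k, inner ℝ (x (S.corner t k)) v / (-inner ℝ (x (S.corner t k)) p.1 - p.2) ^ 2 :=
      Finset.sum_congr rfl fun k _ => by
        rw [← inner_neg_right]
        exact (div_eq_inv_mul _ _).symm
    have e3 : c * inner ℝ p.1 v = 12 * (inner ℝ p.1 v / ‖p.1‖ / (1 - ‖p.1‖) ^ 2) := by
      rw [hc]
      field_simp
    rw [e1, e2, e3]
    linarith
  refine ⟨W / c, by positivity, ∑ k, (a k / W) • x (S.corner s k),
    sum_smul_mem_hull (fun k => (div_pos (ha0 k) hWpos).le)
      (by rw [← Finset.sum_div, div_self hWpos.ne']) (S.corner_mem_triVerts s),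
    ∑ k, (b k / W) • x (S.corner t k),
    sum_smul_mem_hull (fun k => (div_pos (hb0 k) hWpos).le)
      (by rw [← Finset.sum_div, hWb, div_self hWpos.ne']) (S.corner_mem_triVerts t), ?_⟩
  have e : ∀ r : ℝ, W / c * (r / W) = c⁻¹ * r := fun r => by field_simp
  simp only [smul_sub, Finset.smul_sum, smul_smul, e]
  simp only [← smul_smul]
  rw [← Finset.smul_sum, ← Finset.smul_sum, ← smul_sub, ← hkey, smul_smul, inv_mul_cancel₀ hc0.ne',
    one_smul]

theorem nonPrehensile_exactPotential (h : S.exactPotential s t x ≠ ∞) :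
    NonPrehensile (S.exactPotential s t) (S.triVerts s) (S.triVerts t) x := by
  obtain ⟨p, hp, he, h0⟩ := S.exists_optimal h
  have hR := (S.regular_exactPotential h).differentiableAt
  have hcone := hp.normal_mem_forceCone h0
  have hne : ∀ k l, S.corner s k ≠ S.corner t l := fun k l hkl =>
    Set.disjoint_left.1 hp.disjoint_hull
      (subset_convexHull ℝ _ ⟨_, S.corner_mem_triVerts s k, rfl⟩)
      (subset_convexHull ℝ _ ⟨_, S.corner_mem_triVerts t l, by rw [hkl]⟩)
  refine ⟨fun i hi => ?_, fun j hj => ?_⟩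
  · obtain ⟨k, rfl⟩ := S.mem_triVerts.1 hi
    rw [contactForce_eq_of_fderiv (w := (S.slack s t x p (.inl k) ^ 2)⁻¹ • p.1) hR fun v => ?_]
    · exact smul_mem_forceCone (inv_pos.2 (pow_pos (hp.2 _) 2)) hcone
    · rw [S.fderiv_exactPotential hp he, Fintype.sum_sum_type, Finset.sum_eq_single k,
        Finset.sum_eq_zero, real_inner_smul_left]
      · simp [slack, real_inner_comm, div_eq_inv_mul]
      · intro l _
        simp [slack, hne k l]
      · intro l _ hl
        simp [slack, (S.corner_injective s).ne hl]
      · simp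
  · obtain ⟨k, rfl⟩ := S.mem_triVerts.1 hj
    rw [contactForce_eq_of_fderiv (w := (S.slack s t x p (.inr k) ^ 2)⁻¹ • (-p.1)) hR fun v => ?_]
    · exact smul_mem_forceCone (inv_pos.2 (pow_pos (hp.2 _) 2)) (neg_mem_forceCone hcone)
    · rw [S.fderiv_exactPotential hp he, Fintype.sum_sum_type, Finset.sum_eq_zero,
        Finset.sum_eq_single k, real_inner_smul_left]
      · simp [slack, real_inner_comm, div_eq_inv_mul]
      · intro l _ hl
        simp [slack, (S.corner_injective t).ne hl]
      · simp
      · intro l _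
        simp [slack, hne l k]

theorem dependsOn_exactPotential : DependsOn (S.exactPotential s t)
    ((S.triVerts s ∪ S.triVerts t : Finset (Fin V)) : Set (Fin V)) := by
  intro y z h
  have hs : ∀ k, y (S.corner s k) = z (S.corner s k) := fun k =>
    h _ (by simpa using Or.inl (S.corner_mem_triVerts s k))
  have ht : ∀ k, y (S.corner t k) = z (S.corner t k) := fun k =>
    h _ (by simpa using Or.inr (S.corner_mem_triVerts t k))
  simp only [exactPotential, planeObjective, hs, ht]

end Scene

/-! ### Bounding spheres of tree nodes -/

/-- Induction over pairs of tree nodes along the recursion of the hierarchical potential: `Q` is a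
property of the finer potential of a pair, `P` one of its blend with the centered potential. -/
theorem BTree.pair_induction {T : ℕ} {P Q : BTree T → BTree T → Prop}
    (leaf_leaf : ∀ s t, Q (.leaf s) (.leaf t))
    (leaf_node : ∀ s l r, P (.leaf s) l → P (.leaf s) r → Q (.leaf s) (.node l r))
    (node_leaf : ∀ l r t, P l (.leaf t) → P r (.leaf t) → Q (.node l r) (.leaf t))
    (node_node : ∀ l r l' r', P l l' → P l r' → P r l' → P r r' → Q (.node l r) (.node l' r'))
    (blend : ∀ I J, Q I J → P I J) (I J : BTree T) : Q I J ∧ P I J := by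
  suffices h : Q I J from ⟨h, blend I J h⟩
  induction I generalizing J with
  | leaf s =>
    induction J with
    | leaf t => exact leaf_leaf s t
    | node l r hl hr => exact leaf_node s l r (blend _ _ hl) (blend _ _ hr)
  | node l r hl hr =>
    cases J with
    | leaf t => exact node_leaf l r t (blend _ _ (hl _)) (blend _ _ (hr _))
    | node l' r' =>
      exact node_node l r l' r' (blend _ _ (hl _)) (blend _ _ (hl _)) (blend _ _ (hr _))
        (blend _ _ (hr _))

namespace Scene

variable {V T B : ℕ} (S : Scene V T B) {I J l r : BTree T} {x : Config V} {b b' : Fin B} {ε : ℝ}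

theorem mem_verts {i : Fin V} : i ∈ S.verts I ↔ ∃ t, I.HasLeaf t ∧ i ∈ S.triVerts t := by
  induction I with
  | leaf t => simp [verts, BTree.HasLeaf]
  | node l r hl hr =>
    simp only [verts, BTree.HasLeaf, Finset.mem_union, hl, hr, or_and_right, exists_or]

theorem triVerts_subset_verts {t : Fin T} (h : I.HasLeaf t) : S.triVerts t ⊆ S.verts I :=
  fun _ hi => S.mem_verts.2 ⟨t, h, hi⟩

theorem verts_nonempty (I : BTree T) : (S.verts I).Nonempty := by
  induction I with
  | leaf t => exact ⟨_, S.corner_mem_triVerts t 0⟩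
  | node l r hl hr => exact hl.mono Finset.subset_union_left

theorem radius_pos (I : BTree T) : 0 < S.radius I := by
  induction I with
  | leaf t => exact S.leafRadius_pos t
  | node l r hl hr => exact lt_max_of_lt_left (add_pos_of_nonneg_of_pos dist_nonneg hl)

theorem radius_add_radius_pos (I J : BTree T) : 0 < S.radius I + S.radius J :=
  add_pos (S.radius_pos I) (S.radius_pos J)

theorem radius_add_radius_lt (hε : 0 < ε) (I J : BTree T) :
    S.radius I + S.radius J < (1 + ε) * (S.radius I + S.radius J) := by
  have := mul_pos hε (S.radius_add_radius_pos I J)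
  linarith

/-- All triangles stored in the tree `I` belong to the body `b`. -/
def OnBody (b : Fin B) (I : BTree T) : Prop := ∀ t, I.HasLeaf t → S.triBody t = b

theorem onBody_tree (b : Fin B) : S.OnBody b (S.tree b) := fun t => (S.hasLeaf_tree b t).1

theorem OnBody.left {S : Scene V T B} (h : S.OnBody b (.node l r)) : S.OnBody b l :=
  fun t ht => h t (Or.inl ht)

theorem OnBody.right {S : Scene V T B} (h : S.OnBody b (.node l r)) : S.OnBody b r :=
  fun t ht => h t (Or.inr ht)

theorem OnBody.vertexBody {S : Scene V T B} (h : S.OnBody b I) {i : Fin V} (hi : i ∈ S.verts I) :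
    S.vertexBody i = b := by
  obtain ⟨t, ht, hi⟩ := S.mem_verts.1 hi
  obtain ⟨k, rfl⟩ := S.mem_triVerts.1 hi
  rw [S.corner_body, h t ht]

theorem OnBody.disjoint_verts {S : Scene V T B} (hI : S.OnBody b I) (hJ : S.OnBody b' J)
    (hb : b ≠ b') : Disjoint (S.verts I) (S.verts J) :=
  Finset.disjoint_left.2 fun _ hi hj => hb ((hI.vertexBody hi).symm.trans (hJ.vertexBody hj))

/-- In the configuration `x`, the bounding sphere of `I` contains that of `c`. -/
def Nested (x : Config V) (c I : BTree T) : Prop :=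
  dist (center x (S.verts c)) (center x (S.verts I)) + S.radius c ≤ S.radius I

theorem nested_refl (x : Config V) (I : BTree T) : S.Nested x I I := by simp [Nested]

theorem OnBody.dist_center {S : Scene V T B} (h : S.OnBody b I) (hx : x ∈ S.rigidConfigs)
    {K L : Finset (Fin V)} (hK : K ⊆ S.verts I) (hL : L ⊆ S.verts I) (hK0 : K.Nonempty)
    (hL0 : L.Nonempty) :
    dist (center x K) (center x L) = dist (center S.rest K) (center S.rest L) :=
  dist_center_eq (fun i hi j hj => hx i j ((h.vertexBody hi).trans (h.vertexBody hj).symm))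
    hK hL hK0 hL0

theorem OnBody.nested_left {S : Scene V T B} (h : S.OnBody b (.node l r))
    (hx : x ∈ S.rigidConfigs) : S.Nested x l (.node l r) := by
  rw [Nested, h.dist_center hx Finset.subset_union_left subset_rfl (S.verts_nonempty _)
    (S.verts_nonempty _)]
  exact le_max_left _ _

theorem OnBody.nested_right {S : Scene V T B} (h : S.OnBody b (.node l r))
    (hx : x ∈ S.rigidConfigs) : S.Nested x r (.node l r) := by
  rw [Nested, h.dist_center hx Finset.subset_union_right subset_rfl (S.verts_nonempty _)
    (S.verts_nonempty _)]
  exact le_max_right _ _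

/-- The bounding spheres, computed in the rest pose, remain bounding in rigid configurations. -/
theorem OnBody.dist_center_le_radius {S : Scene V T B} (h : S.OnBody b I)
    (hx : x ∈ S.rigidConfigs) {i : Fin V} (hi : i ∈ S.verts I) :
    dist (x i) (center x (S.verts I)) ≤ S.radius I := by
  induction I with
  | leaf t =>
    obtain ⟨k, rfl⟩ := S.mem_triVerts.1 hi
    rw [← center_singleton x, h.dist_center hx (Finset.singleton_subset_iff.2 hi) subset_rfl
      (Finset.singleton_nonempty _) (S.verts_nonempty _), center_singleton, center, verts,
      card_triVerts, sum_triVerts]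
    exact S.leafRadius_bound t k
  | node l r hl hr =>
    rcases Finset.mem_union.1 hi with hi | hi
    · have h1 := hl h.left hi
      have h2 := h.nested_left hx
      have h3 := dist_triangle (x i) (center x (S.verts l)) (center x (S.verts (.node l r)))
      rw [Nested] at h2
      linarith
    · have h1 := hr h.right hi
      have h2 := h.nested_right hx
      have h3 := dist_triangle (x i) (center x (S.verts r)) (center x (S.verts (.node l r)))
      rw [Nested] at h2
      linarith

/-- The distance of the centers of two nodes. -/
def sep (x : Config V) (I J : BTree T) : ℝ := ‖center x (S.verts I) - center x (S.verts J)‖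

theorem sep_eq_dist : S.sep x I J = dist (center x (S.verts I)) (center x (S.verts J)) :=
  (dist_eq_norm _ _).symm

theorem sep_nonneg : 0 ≤ S.sep x I J := norm_nonneg _

theorem Nested.sep_add_radius_le {S : Scene V T B} {c c' : BTree T} (h : S.Nested x c I)
    (h' : S.Nested x c' J) :
    S.sep x c c' + (S.radius c + S.radius c') ≤ S.sep x I J + (S.radius I + S.radius J) := by
  rw [Nested] at h h'
  rw [sep_eq_dist, sep_eq_dist]
  have := dist_triangle4 (center x (S.verts c)) (center x (S.verts I)) (center x (S.verts J))
    (center x (S.verts c'))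
  rw [dist_comm (center x (S.verts J)) (center x (S.verts c'))] at this
  linarith

theorem Nested.radius_le_sep {S : Scene V T B} {c c' : BTree T} (h : S.Nested x c I)
    (h' : S.Nested x c' J) (hD : S.radius I + S.radius J ≤ S.sep x I J) :
    S.radius c + S.radius c' ≤ S.sep x c c' := by
  rw [Nested] at h h'
  rw [sep_eq_dist] at hD ⊢
  have := dist_triangle4 (center x (S.verts I)) (center x (S.verts c)) (center x (S.verts c'))
    (center x (S.verts J))
  rw [dist_comm (center x (S.verts I)) (center x (S.verts c))] at this
  linarith

/-- Some triangle stored in `I` meets some triangle stored in `J`. -/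
def Meets (x : Config V) (I J : BTree T) : Prop :=
  ∃ s t, I.HasLeaf s ∧ J.HasLeaf t ∧ (hull x (S.triVerts s) ∩ hull x (S.triVerts t)).Nonempty

theorem meets_node_left {l r J : BTree T} :
    S.Meets x (.node l r) J ↔ S.Meets x l J ∨ S.Meets x r J := by
  simp only [Meets, BTree.HasLeaf, or_and_right, exists_or]

theorem meets_node_right {I l r : BTree T} :
    S.Meets x I (.node l r) ↔ S.Meets x I l ∨ S.Meets x I r := by
  simp only [Meets, BTree.HasLeaf, or_and_right, and_or_left, exists_or]

theorem Meets.sep_le {S : Scene V T B} (h : S.Meets x I J) (hI : S.OnBody b I)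
    (hJ : S.OnBody b' J) (hx : x ∈ S.rigidConfigs) : S.sep x I J ≤ S.radius I + S.radius J := by
  obtain ⟨s, t, hs, ht, q, hqs, hqt⟩ := h
  have h1 : dist q _ ≤ S.radius I := hull_subset_closedBall
    (fun i hi => hI.dist_center_le_radius hx hi) (hull_mono (S.triVerts_subset_verts hs) hqs)
  have h2 : dist q _ ≤ S.radius J := hull_subset_closedBall
    (fun i hi => hJ.dist_center_le_radius hx hi) (hull_mono (S.triVerts_subset_verts ht) hqt)
  rw [sep_eq_dist]
  have := dist_triangle_left (center x (S.verts I)) (center x (S.verts J)) q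
  linarith

theorem disjoint_hull_verts (h : ¬ S.Meets x I J) (hI : S.OnBody b I) (hJ : S.OnBody b' J)
    (hx : x ∈ S.rigidConfigs) (hD : S.radius I + S.radius J ≤ S.sep x I J) :
    Disjoint (hull x (S.verts I)) (hull x (S.verts J)) := by
  by_contra hne
  rw [Set.not_disjoint_iff_nonempty_inter] at hne
  rw [sep_eq_dist] at hD
  obtain ⟨i, hi, j, hj, hij⟩ := exists_eq_of_hull_inter_hull
    (fun i hi => hI.dist_center_le_radius hx hi) (fun j hj => hJ.dist_center_le_radius hx hj)
    hD hne
  obtain ⟨s, hs, his⟩ := S.mem_verts.1 hi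
  obtain ⟨t, ht, hjt⟩ := S.mem_verts.1 hj
  exact h ⟨s, t, hs, ht, x i, subset_convexHull ℝ _ ⟨i, his, rfl⟩,
    subset_convexHull ℝ _ ⟨j, hjt, hij.symm⟩⟩

/-! ### The hierarchical potential -/

/-- The more accurate potential of a pair of nodes, to be blended with the centered potential: the
exact potential for two leaves, the sum over the pairs of children otherwise. -/
def finePotential (ε : ℝ) : BTree T → BTree T → Config V → ℝ≥0∞
  | .leaf s, .leaf t, x => S.exactPotential s t x
  | .leaf s, .node l r, x => S.nodePotential ε x (.leaf s) l + S.nodePotential ε x (.leaf s) r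
  | .node l r, .leaf t, x => S.nodePotential ε x l (.leaf t) + S.nodePotential ε x r (.leaf t)
  | .node l r, .node l' r', x =>
      S.nodePotential ε x l l' + S.nodePotential ε x l r'
        + (S.nodePotential ε x r l' + S.nodePotential ε x r r')

theorem nodePotential_eq (ε : ℝ) (I J : BTree T) :
    (fun x => S.nodePotential ε x I J) =
      centeredBlend (S.radius I + S.radius J) ((1 + ε) * (S.radius I + S.radius J)) (S.verts I)
        (S.verts J) (S.finePotential ε I J) := by
  funext x
  cases I <;> cases J <;> rw [nodePotential] <;> rfl

theorem nodePotential_eq_finePotential (hε : 0 < ε)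
    (h : S.sep x I J ≤ S.radius I + S.radius J) :
    S.nodePotential ε x I J = S.finePotential ε I J x :=
  (congrFun (S.nodePotential_eq ε I J) x).trans
    (blend_eq_left (S.radius_add_radius_lt hε I J) h _ _)

theorem nodePotential_eventuallyEq (hε : 0 < ε) (h : S.sep x I J < S.radius I + S.radius J) :
    (fun y => S.nodePotential ε y I J) =ᶠ[𝓝 x] S.finePotential ε I J := by
  filter_upwards [(continuous_norm_center_sub (S.verts I) (S.verts J)).continuousAt.eventually_lt
    continuousAt_const h] with y hy
  exact S.nodePotential_eq_finePotential hε (le_of_lt hy)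

theorem regular_finePotential_and_nodePotential (hε : 0 < ε) (x : Config V) (I J : BTree T) :
    (¬ S.Meets x I J → Regular (S.finePotential ε I J) x) ∧
      (¬ S.Meets x I J → Regular (fun y => S.nodePotential ε y I J) x) := by
  refine BTree.pair_induction (Q := fun I J => ¬ S.Meets x I J → Regular (S.finePotential ε I J) x)
    (P := fun I J => ¬ S.Meets x I J → Regular (fun y => S.nodePotential ε y I J) x)
    ?_ ?_ ?_ ?_ ?_ I J
  · intro s t h
    refine S.regular_exactPotential fun h' => h ?_
    exact ⟨s, t, rfl, rfl, S.exactPotential_eq_top_iff.1 h'⟩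
  · intro s l r hl hr h
    rw [meets_node_right, not_or] at h
    exact (hl h.1).add (hr h.2)
  · intro l r t hl hr h
    rw [meets_node_left, not_or] at h
    exact (hl h.1).add (hr h.2)
  · intro l r l' r' h1 h2 h3 h4 h
    rw [meets_node_left, meets_node_right, meets_node_right] at h
    simp only [not_or] at h
    exact ((h1 h.1.1).add (h2 h.1.2)).add ((h3 h.2.1).add (h4 h.2.2))
  · intro I J hQ h
    rw [nodePotential_eq]
    exact (hQ h).centeredBlend (S.radius_add_radius_pos I J) (S.radius_add_radius_lt hε I J)

theorem regular_finePotential (hε : 0 < ε) (h : ¬ S.Meets x I J) :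
    Regular (S.finePotential ε I J) x :=
  (S.regular_finePotential_and_nodePotential hε x I J).1 h

theorem regular_nodePotential (hε : 0 < ε) (h : ¬ S.Meets x I J) :
    Regular (fun y => S.nodePotential ε y I J) x :=
  (S.regular_finePotential_and_nodePotential hε x I J).2 h

/-- Where triangles of two nodes meet, the bounding spheres overlap, so that the recursion descends
to the exact potential of these triangles. -/
theorem nodePotential_eq_top (hε : 0 < ε) (hx : x ∈ S.rigidConfigs) (I J : BTree T)
    (hI : S.OnBody b I) (hJ : S.OnBody b' J) (h : S.Meets x I J) :
    S.nodePotential ε x I J = ∞ := by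
  revert h hJ hI
  refine (BTree.pair_induction (Q := fun I J => S.OnBody b I → S.OnBody b' J → S.Meets x I J →
    S.finePotential ε I J x = ∞) (P := fun I J => S.OnBody b I → S.OnBody b' J → S.Meets x I J →
    S.nodePotential ε x I J = ∞) ?_ ?_ ?_ ?_ ?_ I J).2
  · rintro s t hI hJ ⟨s', t', rfl, rfl, h⟩
    exact S.exactPotential_eq_top_iff.2 h
  · intro s l r hl hr hI hJ h
    rcases S.meets_node_right.1 h with h | h
    · simp [finePotential, hl hI hJ.left h]
    · simp [finePotential, hr hI hJ.right h]
  · intro l r t hl hr hI hJ h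
    rcases S.meets_node_left.1 h with h | h
    · simp [finePotential, hl hI.left hJ h]
    · simp [finePotential, hr hI.right hJ h]
  · intro l r l' r' h1 h2 h3 h4 hI hJ h
    rw [meets_node_left, meets_node_right, meets_node_right] at h
    rcases h with (h | h) | (h | h)
    · simp [finePotential, h1 hI.left hJ.left h]
    · simp [finePotential, h2 hI.left hJ.right h]
    · simp [finePotential, h3 hI.right hJ.left h]
    · simp [finePotential, h4 hI.right hJ.right h]
  · intro I J hQ hI hJ h
    rw [S.nodePotential_eq_finePotential hε (h.sep_le hI hJ hx)]
    exact hQ hI hJ h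

theorem nodePotential_eq_top_iff (hε : 0 < ε) (hx : x ∈ S.rigidConfigs) (hI : S.OnBody b I)
    (hJ : S.OnBody b' J) : S.nodePotential ε x I J = ∞ ↔ S.Meets x I J := by
  refine ⟨fun h => ?_, S.nodePotential_eq_top hε hx I J hI hJ⟩
  by_contra hne
  exact (S.regular_nodePotential hε hne).ne_top h

theorem continuousWithinAt_nodePotential (hε : 0 < ε) (hx : x ∈ S.rigidConfigs) (I J : BTree T)
    (hI : S.OnBody b I) (hJ : S.OnBody b' J) :
    ContinuousWithinAt (fun y => S.nodePotential ε y I J) S.rigidConfigs x := by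
  revert hJ hI
  refine (BTree.pair_induction (Q := fun I J => S.OnBody b I → S.OnBody b' J →
    ContinuousWithinAt (S.finePotential ε I J) S.rigidConfigs x)
    (P := fun I J => S.OnBody b I → S.OnBody b' J →
    ContinuousWithinAt (fun y => S.nodePotential ε y I J) S.rigidConfigs x) ?_ ?_ ?_ ?_ ?_ I J).2
  · exact fun s t _ _ => S.continuous_exactPotential.continuousWithinAt
  · exact fun s l r hl hr hI hJ => (hl hI hJ.left).add (hr hI hJ.right)
  · exact fun l r t hl hr hI hJ => (hl hI.left hJ).add (hr hI.right hJ)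
  · exact fun l r l' r' h1 h2 h3 h4 hI hJ => ((h1 hI.left hJ.left).add (h2 hI.left hJ.right)).add
      ((h3 hI.right hJ.left).add (h4 hI.right hJ.right))
  · intro I J hQ hI hJ
    rw [nodePotential_eq]
    refine continuousWithinAt_centeredBlend (S.radius_add_radius_pos I J)
      (S.radius_add_radius_lt hε I J) (hQ hI hJ) fun hD => ?_
    exact (S.regular_finePotential hε fun h => hD.not_ge (h.sep_le hI hJ hx)).ne_top

theorem dependsOn_nodePotential (ε : ℝ) (I J : BTree T) :
    DependsOn (fun y => S.nodePotential ε y I J)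
      ((S.verts I ∪ S.verts J : Finset (Fin V)) : Set (Fin V)) := by
  refine (BTree.pair_induction (Q := fun I J => DependsOn (S.finePotential ε I J)
      ((S.verts I ∪ S.verts J : Finset (Fin V)) : Set (Fin V)))
    (P := fun I J => DependsOn (fun y => S.nodePotential ε y I J)
      ((S.verts I ∪ S.verts J : Finset (Fin V)) : Set (Fin V))) ?_ ?_ ?_ ?_ ?_ I J).2
  · exact fun s t => S.dependsOn_exactPotential
  · intro s l r hl hr
    have := dependsOn_add hl hr
    rwa [Finset.union_self] at this
  · intro l r t hl hr
    have := dependsOn_add hl hr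
    rwa [Finset.union_self] at this
  · intro l r l' r' h1 h2 h3 h4
    have := dependsOn_add (dependsOn_add h1 h2) (dependsOn_add h3 h4)
    rwa [Finset.union_self, Finset.union_self, Finset.union_self] at this
  · intro I J hQ
    rw [nodePotential_eq]
    exact dependsOn_centeredBlend hQ (by simp) (by simp)

/-! ### Comparison with the centered potential -/

theorem le_centeredPotential {K L : Finset (Fin V)} {M : ℝ}
    (h : ‖center x K - center x L‖ ≤ M) :
    ENNReal.ofReal (centeredReal M) ≤ centeredPotential K L x := by
  -- for coinciding centers the right-hand side is `∞`
  rcases (norm_nonneg (center x K - center x L)).eq_or_lt with h0 | h0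
  · simp [centeredPotential, ← h0]
  · rw [centeredPotential_eq h0]
    exact ENNReal.ofReal_le_ofReal (centeredReal_antitone h0 h)

theorem centeredReal_le_two_mul {D : ℝ} (hD : 0 < D) :
    centeredReal D ≤ 2 * centeredReal (2 * D) := by
  have hu : 0 < (√D)⁻¹ := inv_pos.2 (Real.sqrt_pos.2 hD)
  have hv : 0 < (√(2 * D))⁻¹ := inv_pos.2 (Real.sqrt_pos.2 (by positivity))
  have huv : (√D)⁻¹ ^ 2 = 2 * (√(2 * D))⁻¹ ^ 2 := by
    rw [inv_pow, inv_pow, Real.sq_sqrt hD.le, Real.sq_sqrt (by positivity)]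
    field_simp
  have hle : (√D)⁻¹ ≤ 2 * (√(2 * D))⁻¹ := by
    refine le_of_sq_le_sq ?_ (by positivity)
    rw [mul_pow, huv]
    nlinarith [sq_nonneg (√(2 * D))⁻¹]
  unfold centeredReal
  nlinarith

/-- A lower bound for the hierarchical potential that needs no separation: the centered potential
at the distance of the centers increased by both radii, a quantity that decreases along the
tree. -/
theorem le_nodePotential (hx : x ∈ S.rigidConfigs) (I J : BTree T)
    (hI : S.OnBody b I) (hJ : S.OnBody b' J) :
    ENNReal.ofReal (centeredReal (S.sep x I J + (S.radius I + S.radius J))) ≤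
      S.nodePotential ε x I J := by
  have mono : ∀ {I J c c' : BTree T}, S.Nested x c I → S.Nested x c' J →
      ENNReal.ofReal (centeredReal (S.sep x I J + (S.radius I + S.radius J))) ≤
      ENNReal.ofReal (centeredReal (S.sep x c c' + (S.radius c + S.radius c'))) :=
    fun h h' => ENNReal.ofReal_le_ofReal (centeredReal_antitone
      (add_pos_of_nonneg_of_pos S.sep_nonneg (S.radius_add_radius_pos _ _))
      (h.sep_add_radius_le h'))
  have cent : ∀ I J : BTree T,
      ENNReal.ofReal (centeredReal (S.sep x I J + (S.radius I + S.radius J))) ≤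
        centeredPotential (S.verts I) (S.verts J) x := fun I J =>
    le_centeredPotential (le_add_of_nonneg_right (S.radius_add_radius_pos I J).le)
  revert hJ hI
  refine (BTree.pair_induction (Q := fun I J => S.OnBody b I → S.OnBody b' J →
    ENNReal.ofReal (centeredReal (S.sep x I J + (S.radius I + S.radius J))) ≤
      S.finePotential ε I J x) (P := fun I J => S.OnBody b I → S.OnBody b' J →
    ENNReal.ofReal (centeredReal (S.sep x I J + (S.radius I + S.radius J))) ≤
      S.nodePotential ε x I J) ?_ ?_ ?_ ?_ ?_ I J).2
  · exact fun s t _ _ => (cent _ _).trans S.centeredPotential_le_exactPotential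
  · exact fun s l r hl hr hI hJ => ((mono (S.nested_refl x _) (hJ.nested_left hx)).trans
      (hl hI hJ.left)).trans le_self_add
  · exact fun l r t hl hr hI hJ => ((mono (hI.nested_left hx) (S.nested_refl x _)).trans
      (hl hI.left hJ)).trans le_self_add
  · exact fun l r l' r' h1 h2 h3 h4 hI hJ =>
      (((mono (hI.nested_left hx) (hJ.nested_left hx)).trans (h1 hI.left hJ.left)).trans
        le_self_add).trans le_self_add
  · intro I J hQ hI hJ
    refine (?_ : _ ≤ (fun y => S.nodePotential ε y I J) x)
    rw [nodePotential_eq]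
    exact le_centeredBlend (hQ hI hJ) (cent I J)

/-- Where the bounding spheres do not overlap, the centered potential is at most the finer one. For
pairs with children this holds because there are at least two pairs of children, each at
distance at most twice the distance of the centers. -/
theorem centeredPotential_le_finePotential (hx : x ∈ S.rigidConfigs) (hI : S.OnBody b I)
    (hJ : S.OnBody b' J) (hD : S.radius I + S.radius J ≤ S.sep x I J) :
    centeredPotential (S.verts I) (S.verts J) x ≤ S.finePotential ε I J x := by
  have hpos : 0 < S.sep x I J := (S.radius_add_radius_pos I J).trans_le hD
  have child : ∀ {c c' : BTree T}, S.Nested x c I → S.Nested x c' J → S.OnBody b c →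
      S.OnBody b' c' → ENNReal.ofReal (centeredReal (2 * S.sep x I J)) ≤
        S.nodePotential ε x c c' := fun h h' hc hc' =>
    (ENNReal.ofReal_le_ofReal (centeredReal_antitone
      (add_pos_of_nonneg_of_pos S.sep_nonneg (S.radius_add_radius_pos _ _))
      ((h.sep_add_radius_le h').trans (by linarith)))).trans (S.le_nodePotential hx _ _ hc hc')
  have two : centeredPotential (S.verts I) (S.verts J) x ≤
      ENNReal.ofReal (centeredReal (2 * S.sep x I J))
        + ENNReal.ofReal (centeredReal (2 * S.sep x I J)) := by
    have h0 : 0 ≤ centeredReal (2 * S.sep x I J) := by unfold centeredReal; positivity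
    rw [centeredPotential_eq hpos, ← ENNReal.ofReal_add h0 h0, ← two_mul]
    exact ENNReal.ofReal_le_ofReal (centeredReal_le_two_mul hpos)
  cases I with
  | leaf s =>
    cases J with
    | leaf t => exact S.centeredPotential_le_exactPotential
    | node l r => exact two.trans (add_le_add
        (child (S.nested_refl x _) (hJ.nested_left hx) hI hJ.left)
        (child (S.nested_refl x _) (hJ.nested_right hx) hI hJ.right))
  | node l r =>
    cases J with
    | leaf t => exact two.trans (add_le_add
        (child (hI.nested_left hx) (S.nested_refl x _) hI.left hJ)
        (child (hI.nested_right hx) (S.nested_refl x _) hI.right hJ))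
    | node l' r' => exact two.trans (add_le_add
        ((child (hI.nested_left hx) (hJ.nested_left hx) hI.left hJ.left).trans le_self_add)
        ((child (hI.nested_right hx) (hJ.nested_left hx) hI.right hJ.left).trans le_self_add))

/-- Where the bounding spheres do not overlap, the hierarchical potential exerts only non-prehensile
forces. The spheres of the children do not overlap either. -/
theorem nonPrehensile_nodePotential (hε : 0 < ε) (hx : x ∈ S.rigidConfigs) (hb : b ≠ b')
    (I J : BTree T) (hI : S.OnBody b I) (hJ : S.OnBody b' J) (h : ¬ S.Meets x I J)
    (hD : S.radius I + S.radius J ≤ S.sep x I J) :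
    NonPrehensile (fun y => S.nodePotential ε y I J) (S.verts I) (S.verts J) x := by
  revert hD h hJ hI
  refine (BTree.pair_induction (Q := fun I J => S.OnBody b I → S.OnBody b' J → ¬ S.Meets x I J →
    S.radius I + S.radius J ≤ S.sep x I J →
    NonPrehensile (S.finePotential ε I J) (S.verts I) (S.verts J) x)
    (P := fun I J => S.OnBody b I → S.OnBody b' J → ¬ S.Meets x I J →
    S.radius I + S.radius J ≤ S.sep x I J →
    NonPrehensile (fun y => S.nodePotential ε y I J) (S.verts I) (S.verts J) x)
    ?_ ?_ ?_ ?_ ?_ I J).2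
  · intro s t _ _ h _
    exact S.nonPrehensile_exactPotential fun h' =>
      h ⟨s, t, rfl, rfl, S.exactPotential_eq_top_iff.1 h'⟩
  · intro s l r hl hr hI hJ h hD
    have hd := hI.disjoint_verts hJ hb
    rw [meets_node_right, not_or] at h
    have := (hl hI hJ.left h.1 ((S.nested_refl x _).radius_le_sep (hJ.nested_left hx) hD)).add
      (hr hI hJ.right h.2 ((S.nested_refl x _).radius_le_sep (hJ.nested_right hx) hD))
      (S.regular_nodePotential hε h.1) (S.regular_nodePotential hε h.2)
      (S.dependsOn_nodePotential ε _ _) (S.dependsOn_nodePotential ε _ _)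
      (by rwa [Finset.union_self])
    rwa [Finset.union_self] at this
  · intro l r t hl hr hI hJ h hD
    have hd := hI.disjoint_verts hJ hb
    rw [meets_node_left, not_or] at h
    have := (hl hI.left hJ h.1 ((hI.nested_left hx).radius_le_sep (S.nested_refl x _) hD)).add
      (hr hI.right hJ h.2 ((hI.nested_right hx).radius_le_sep (S.nested_refl x _) hD))
      (S.regular_nodePotential hε h.1) (S.regular_nodePotential hε h.2)
      (S.dependsOn_nodePotential ε _ _) (S.dependsOn_nodePotential ε _ _)
      (by rwa [Finset.union_self])
    rwa [Finset.union_self] at this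
  · intro l r l' r' h1 h2 h3 h4 hI hJ h hD
    have hd := hI.disjoint_verts hJ hb
    have hdl := hI.left.disjoint_verts hJ hb
    have hdr := hI.right.disjoint_verts hJ hb
    rw [meets_node_left, meets_node_right, meets_node_right] at h
    simp only [not_or] at h
    obtain ⟨⟨m1, m2⟩, m3, m4⟩ := h
    have nl := hI.nested_left hx
    have nr := hI.nested_right hx
    have nl' := hJ.nested_left hx
    have nr' := hJ.nested_right hx
    have dep := S.dependsOn_nodePotential ε
    have el := (h1 hI.left hJ.left m1 (nl.radius_le_sep nl' hD)).add
      (h2 hI.left hJ.right m2 (nl.radius_le_sep nr' hD))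
      (S.regular_nodePotential hε m1) (S.regular_nodePotential hε m2) (dep _ _) (dep _ _)
      (by rwa [Finset.union_self])
    have er := (h3 hI.right hJ.left m3 (nr.radius_le_sep nl' hD)).add
      (h4 hI.right hJ.right m4 (nr.radius_le_sep nr' hD))
      (S.regular_nodePotential hε m3) (S.regular_nodePotential hε m4) (dep _ _) (dep _ _)
      (by rwa [Finset.union_self])
    rw [Finset.union_self] at el er
    have depl : ∀ c : BTree T, DependsOn
        (fun y => S.nodePotential ε y c l' + S.nodePotential ε y c r')
        ((S.verts c ∪ (S.verts l' ∪ S.verts r') : Finset (Fin V)) : Set (Fin V)) := fun c => by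
      have := dependsOn_add (dep c l') (dep c r')
      rwa [Finset.union_self] at this
    have := el.add er ((S.regular_nodePotential hε m1).add (S.regular_nodePotential hε m2))
      ((S.regular_nodePotential hε m3).add (S.regular_nodePotential hε m4)) (depl l) (depl r)
      (by rwa [Finset.union_self])
    rwa [Finset.union_self] at this
  · intro I J hQ hI hJ h hD
    rw [nodePotential_eq]
    exact (hQ hI hJ h hD).centeredBlend (S.regular_finePotential hε h)
      (S.radius_add_radius_pos I J) (S.radius_add_radius_lt hε I J) hD
      (S.centeredPotential_le_finePotential hx hI hJ hD) (hI.disjoint_verts hJ hb)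
      (S.verts_nonempty I) (S.verts_nonempty J)

end Scene

/-! ### Decomposition into pairwise terms -/

section Decomposition

variable {V : ℕ} {F : Set (Config V)} {K K₁ K₂ : Set (Finset (Fin V))}
  {P P₁ P₂ : Config V → ℝ≥0∞}

/-- At `x`, the term `Q` acts between the separated vertex clusters `I` and `J` by non-prehensile,
non-vanishing forces. -/
def IsContactTerm (Q : Config V → ℝ≥0∞) (I J : Finset (Fin V)) (x : Config V) : Prop :=
  Disjoint I J ∧ Disjoint (hull x I) (hull x J) ∧ NonPrehensile Q I J x ∧
    ∀ i ∈ I ∪ J, contactForce Q x i ≠ 0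

theorem NonPrehensile.isContactTerm {Q : Config V → ℝ≥0∞} {I J : Finset (Fin V)} {x : Config V}
    (h : NonPrehensile Q I J x) (hd : Disjoint I J) (hh : Disjoint (hull x I) (hull x J)) :
    IsContactTerm Q I J x :=
  ⟨hd, hh, h, fun _ hi => h.contactForce_ne_zero hh hi⟩

/-- There is a finite family of local terms such that near each configuration of `F` the potential
`P` is the sum of contact terms of the family which cover all vertex sets in `K`. -/
def Decomposable (F : Set (Config V)) (K : Set (Finset (Fin V))) (P : Config V → ℝ≥0∞) : Prop :=
  ∃ (ι : Type) (_ : Fintype ι) (I J : ι → Finset (Fin V)) (Q : ι → Config V → ℝ≥0∞),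
    (∀ k, DependsOn (Q k) ((I k ∪ J k : Finset (Fin V)) : Set (Fin V))) ∧
    ∀ x ∈ F, ∃ A : Finset ι, (∀ k ∈ A, IsContactTerm (Q k) (I k) (J k) x) ∧
      (P =ᶠ[𝓝 x] fun y => ∑ k ∈ A, Q k y) ∧ ∀ U ∈ K, ∃ k ∈ A, U ⊆ I k ∪ J k

theorem decomposable_zero : Decomposable F ∅ (fun _ => 0) :=
  ⟨Empty, inferInstance, fun _ => ∅, fun _ => ∅, fun _ _ => 0, fun k => k.elim,
    fun _ _ => ⟨∅, by simp, by simp, by simp⟩⟩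

theorem Decomposable.add (h₁ : Decomposable F K₁ P₁) (h₂ : Decomposable F K₂ P₂) :
    Decomposable F (K₁ ∪ K₂) (fun y => P₁ y + P₂ y) := by
  obtain ⟨ι₁, _, I₁, J₁, Q₁, l₁, h₁⟩ := h₁
  obtain ⟨ι₂, _, I₂, J₂, Q₂, l₂, h₂⟩ := h₂
  refine ⟨ι₁ ⊕ ι₂, inferInstance, Sum.elim I₁ I₂, Sum.elim J₁ J₂, Sum.elim Q₁ Q₂, ?_,
    fun x hx => ?_⟩
  · rintro (k | k)
    exacts [l₁ k, l₂ k]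
  obtain ⟨A₁, c₁, s₁, u₁⟩ := h₁ x hx
  obtain ⟨A₂, c₂, s₂, u₂⟩ := h₂ x hx
  refine ⟨A₁.disjSum A₂, ?_, ?_, ?_⟩
  · rintro (k | k) hk
    · exact c₁ k (by simpa using hk)
    · exact c₂ k (by simpa using hk)
  · filter_upwards [s₁, s₂] with y hy₁ hy₂
    simp [Finset.sum_disjSum, hy₁, hy₂]
  · rintro U (hU | hU)
    · obtain ⟨k, hk, hUk⟩ := u₁ U hU
      exact ⟨.inl k, by simpa using hk, hUk⟩
    · obtain ⟨k, hk, hUk⟩ := u₂ U hU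
      exact ⟨.inr k, by simpa using hk, hUk⟩

theorem decomposable_sum {ι : Type*} (s : Finset ι) {K : ι → Set (Finset (Fin V))}
    {P : ι → Config V → ℝ≥0∞} (h : ∀ k ∈ s, Decomposable F (K k) (P k)) :
    Decomposable F (⋃ k ∈ s, K k) (fun y => ∑ k ∈ s, P k y) := by
  classical
  induction s using Finset.induction_on with
  | empty => simpa using decomposable_zero
  | insert k s hk ih =>
    simp only [Finset.sum_insert hk, Finset.set_biUnion_insert]
    exact (h k (by simp)).add (ih fun l hl => h l (by simp [hl]))

theorem decomposable_single {I J : Finset (Fin V)}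
    (hl : DependsOn P ((I ∪ J : Finset (Fin V)) : Set (Fin V)))
    (h : ∀ x ∈ F, IsContactTerm P I J x) (hK : ∀ U ∈ K, U ⊆ I ∪ J) : Decomposable F K P :=
  ⟨Unit, inferInstance, fun _ => I, fun _ => J, fun _ => P, fun _ => hl, fun x hx =>
    ⟨{()}, fun _ _ => h x hx, by simp,
      fun U hU => ⟨(), by simp, hK U hU⟩⟩⟩

/-- A potential which, at each configuration, is a contact term itself or agrees locally with a
decomposable potential is decomposable. -/
theorem Decomposable.switch (hP : Decomposable F K P₁) {I J : Finset (Fin V)}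
    (hl : DependsOn P ((I ∪ J : Finset (Fin V)) : Set (Fin V)))
    (h : ∀ x ∈ F, IsContactTerm P I J x ∨ P =ᶠ[𝓝 x] P₁) (hK : ∀ U ∈ K, U ⊆ I ∪ J) :
    Decomposable F K P := by
  obtain ⟨ι, _, I', J', Q, l, hd⟩ := hP
  refine ⟨Option ι, inferInstance, fun k => k.elim I I', fun k => k.elim J J',
    fun k => k.elim P Q, ?_, fun x hx => ?_⟩
  · rintro (_ | k)
    exacts [hl, l k]
  rcases h x hx with h | h
  · refine ⟨{none}, ?_, by simp, fun U hU => ⟨none, by simp, hK U hU⟩⟩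
    simpa using h
  · obtain ⟨A, c, s, u⟩ := hd x hx
    refine ⟨A.map Function.Embedding.some, ?_, ?_, fun U hU => ?_⟩
    · intro k hk
      obtain ⟨k, hk', rfl⟩ := Finset.mem_map.1 hk
      exact c k hk'
    · filter_upwards [h, s] with y hy hs
      rw [hy, hs, Finset.sum_map]
      rfl
    · obtain ⟨k, hk, hUk⟩ := u U hU
      exact ⟨some k, by simpa using hk, hUk⟩

end Decomposition

namespace Scene

variable {V T B : ℕ} (S : Scene V T B) {C : Set (Config V)} {x : Config V} {b b' : Fin B} {ε : ℝ}

theorem not_meets_of_mem_free (hx : x ∈ S.free C) (hb : b ≠ b') {I J : BTree T}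
    (hI : S.OnBody b I) (hJ : S.OnBody b' J) : ¬ S.Meets x I J := by
  rintro ⟨s, t, hs, ht, h⟩
  exact hx.2 ⟨hx.1, s, t, by rw [hI s hs, hJ t ht]; exact hb, h⟩

/-- The vertex sets of the pairs of a triangle stored in `I` and a triangle stored in `J`. -/
def trianglePairs (I J : BTree T) : Set (Finset (Fin V)) :=
  {U | ∃ s t, I.HasLeaf s ∧ J.HasLeaf t ∧ U = S.triVerts s ∪ S.triVerts t}

theorem trianglePairs_node_left (l r J : BTree T) :
    S.trianglePairs (.node l r) J = S.trianglePairs l J ∪ S.trianglePairs r J := by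
  ext U
  simp only [trianglePairs, BTree.HasLeaf, Set.mem_union, Set.mem_ofPred_eq, or_and_right,
    exists_or]

theorem trianglePairs_node_right (I l r : BTree T) :
    S.trianglePairs I (.node l r) = S.trianglePairs I l ∪ S.trianglePairs I r := by
  ext U
  simp only [trianglePairs, BTree.HasLeaf, Set.mem_union, Set.mem_ofPred_eq, or_and_right,
    and_or_left, exists_or]

/-- The recursion stops at the pairs of nodes whose bounding spheres do not overlap, which are
contact terms, or at pairs of leaves. -/
theorem decomposable_nodePotential (hC : C ⊆ S.rigidConfigs) (hε : 0 < ε) (hb : b ≠ b')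
    (I J : BTree T) (hI : S.OnBody b I) (hJ : S.OnBody b' J) :
    Decomposable (S.free C) (S.trianglePairs I J) (fun y => S.nodePotential ε y I J) := by
  revert hJ hI
  refine (BTree.pair_induction (Q := fun I J => S.OnBody b I → S.OnBody b' J →
    Decomposable (S.free C) (S.trianglePairs I J) (S.finePotential ε I J))
    (P := fun I J => S.OnBody b I → S.OnBody b' J →
    Decomposable (S.free C) (S.trianglePairs I J) (fun y => S.nodePotential ε y I J))
    ?_ ?_ ?_ ?_ ?_ I J).2
  · intro s t hI hJ
    refine decomposable_single (I := S.triVerts s) (J := S.triVerts t) S.dependsOn_exactPotential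
      (fun x hx => ?_) ?_
    · have hne : ¬ (hull x (S.triVerts s) ∩ hull x (S.triVerts t)).Nonempty := fun h =>
        S.not_meets_of_mem_free hx hb hI hJ ⟨s, t, rfl, rfl, h⟩
      refine (S.nonPrehensile_exactPotential fun h =>
        hne (S.exactPotential_eq_top_iff.1 h)).isContactTerm (hI.disjoint_verts hJ hb) ?_
      rwa [← Set.not_disjoint_iff_nonempty_inter, not_not] at hne
    · rintro U ⟨s', t', rfl, rfl, rfl⟩
      rfl
  · intro s l r hl hr hI hJ
    rw [trianglePairs_node_right]
    exact (hl hI hJ.left).add (hr hI hJ.right)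
  · intro l r t hl hr hI hJ
    rw [trianglePairs_node_left]
    exact (hl hI.left hJ).add (hr hI.right hJ)
  · intro l r l' r' h1 h2 h3 h4 hI hJ
    rw [trianglePairs_node_left, trianglePairs_node_right, trianglePairs_node_right]
    exact ((h1 hI.left hJ.left).add (h2 hI.left hJ.right)).add
      ((h3 hI.right hJ.left).add (h4 hI.right hJ.right))
  · intro I J hQ hI hJ
    refine (hQ hI hJ).switch (S.dependsOn_nodePotential ε I J) (fun x hx => ?_) ?_
    · have hm := S.not_meets_of_mem_free hx hb hI hJ
      have hr := hC hx.1
      rcases lt_or_ge (S.sep x I J) (S.radius I + S.radius J) with h | h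
      · exact Or.inr (S.nodePotential_eventuallyEq hε h)
      · exact Or.inl ((S.nonPrehensile_nodePotential hε hr hb I J hI hJ hm h).isContactTerm
          (hI.disjoint_verts hJ hb) (S.disjoint_hull_verts hm hI hJ hr h))
    · rintro U ⟨s, t, hs, ht, rfl⟩
      exact Finset.union_subset_union (S.triVerts_subset_verts hs) (S.triVerts_subset_verts ht)

/-! ### The contact potential of a scene -/

theorem exists_meets_iff : (∃ p : Fin B × Fin B, p.1 < p.2 ∧ S.Meets x (S.tree p.1) (S.tree p.2)) ↔
    ∃ s t, S.triBody s ≠ S.triBody t ∧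
      (hull x (S.triVerts s) ∩ hull x (S.triVerts t)).Nonempty := by
  constructor
  · rintro ⟨p, hp, s, t, hs, ht, h⟩
    refine ⟨s, t, ?_, h⟩
    rw [S.onBody_tree _ s hs, S.onBody_tree _ t ht]
    exact hp.ne
  · rintro ⟨s, t, hst, h⟩
    rcases lt_or_gt_of_ne hst with hlt | hlt
    · exact ⟨(_, _), hlt, s, t, (S.hasLeaf_tree _ s).2 rfl, (S.hasLeaf_tree _ t).2 rfl, h⟩
    · exact ⟨(_, _), hlt, t, s, (S.hasLeaf_tree _ t).2 rfl, (S.hasLeaf_tree _ s).2 rfl,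
        Set.inter_comm _ _ ▸ h⟩

theorem propertyA_potential (hC : C ⊆ S.rigidConfigs) (hε : 0 < ε) :
    S.PropertyA C (S.potential ε) := by
  refine ⟨fun _ _ => zero_le, fun x hx => ?_, fun x hx => ?_⟩
  · refine ContinuousWithinAt.mono (t := S.rigidConfigs) ?_ hC
    exact tendsto_finsetSum _ fun p _ => S.continuousWithinAt_nodePotential hε (hC hx) _ _
      (S.onBody_tree p.1) (S.onBody_tree p.2)
  · rw [potential, ENNReal.sum_eq_top]
    simp only [Finset.mem_filter_univ, S.nodePotential_eq_top_iff hε (hC hx) (S.onBody_tree _)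
      (S.onBody_tree _)]
    rw [S.exists_meets_iff]
    exact (and_iff_right hx).symm

theorem propertyB_potential (C : Set (Config V)) (hε : 0 < ε) :
    S.PropertyB C (S.potential ε) := by
  intro x hx
  have h : Regular (S.potential ε) x := regular_sum fun p hp => S.regular_nodePotential hε
    (S.not_meets_of_mem_free hx (by simpa using hp : p.1 < p.2).ne (S.onBody_tree _)
      (S.onBody_tree _))
  exact ⟨h.1, h.twiceDifferentiableAt⟩

theorem propertyC_potential (hC : C ⊆ S.rigidConfigs) (hε : 0 < ε) :
    S.PropertyC C (S.potential ε) := by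
  obtain ⟨ι, hι, I, J, Q, hl, h⟩ := decomposable_sum (F := S.free C)
    (Finset.univ.filter fun p : Fin B × Fin B => p.1 < p.2) fun p hp =>
      S.decomposable_nodePotential hC hε (by simpa using hp : p.1 < p.2).ne _ _
        (S.onBody_tree p.1) (S.onBody_tree p.2)
  refine ⟨ι, hι, I, J, Q, fun k x y hxy => hl k hxy, fun x hx => ?_⟩
  obtain ⟨A, h1, h2, h3⟩ := h x hx
  refine ⟨A, h1, h2, fun s t hst => h3 _ ?_⟩
  simp only [Set.mem_iUnion]
  rcases lt_or_gt_of_ne hst with hlt | hlt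
  · exact ⟨(_, _), by simpa using hlt, s, t, (S.hasLeaf_tree _ s).2 rfl,
      (S.hasLeaf_tree _ t).2 rfl, rfl⟩
  · exact ⟨(_, _), by simpa using hlt, t, s, (S.hasLeaf_tree _ t).2 rfl,
      (S.hasLeaf_tree _ s).2 rfl, Finset.union_comm _ _⟩

end Scene

end ContactBSH

end

theorem mainTheorem1 {V T B : ℕ} (S : ContactBSH.Scene V T B)
    (C : Set (ContactBSH.Config V)) (hC : C ⊆ S.rigidConfigs) (ε : ℝ) (hε : 0 < ε) :
    S.PropertyA C (S.potential ε) ∧ S.PropertyB C (S.potential ε) ∧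
      S.PropertyC C (S.potential ε) := by
  exact ⟨S.propertyA_potential hC hε, S.propertyB_potential C hε, S.propertyC_potential hC hε⟩
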